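/- \textbf{Conventions.} A \emph{complete monoid} is a commutative monoid in which every countable family has a sum, extending finite sums and satisfying partition associativity. Let $R$ be a complete commutative semiring (multiplication distributes over countable sums) in which every integer $n\geq 1$ has a multiplicative inverse $\frac1n$. A \emph{complete $R$-semimodule} is a complete monoid with a (unital) $R$-action preserving countable sums in each variable; a map of such is $R$-additive if it preserves countable sums and the action. A \emph{cartesian left $R$-additive category with countable sums} is a category $\mathcal C$ with finite products whose hom-sets are complete $R$-semimodules, such that each $g\mapsto g\circ f$ is $R$-additive and the product projections $p$ are $R$-additive (i.e. each $f\mapsto p\circ f$ is). It is a \emph{cartesian differential category with countable sums} if it has a derivative: operators $d:\mathcal C(X,Y)\to\mathcal C(X\times X,Y)$ such that $d$ is $R$-additive, $d\,\mathrm{id}=\pi_1$, $d p=p\circ\pi_1$ for product projections $p$, $d(g\circ f)=dg\circ\langle f\circ\pi_0,df\rangle$, $df$ is $R$-additive in its second argument, $ddf\circ\langle x,0,0,u\rangle=df\circ\langle x,u\rangle$ and $ddf\circ\langle x,u,v,w\rangle=ddf\circ\langle x,v,u,w\rangle$. Assume that every object $X$ has a countable power $S_\omega X=\prod_{i\in\mathbb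 N}X$ whose projections $\pi_k$ are $R$-additive and $d$-linear ($d\pi_k=\pi_k\circ\pi_1$). Write $S_\omega f$ for the coordinatewise action on morphisms. Define $f^{(0)}=f$ and $f^{(n+1)}\circ\langle x,u_1,\dots,u_{n+1}\rangle=d f^{(n)}\circ\langle (x,u_1,\dots,u_n),(u_{n+1},0,\dots,0)\rangle$. The category is \emph{Taylor} if for all $f\in\mathcal C(X,Y)$, $x,u\in\mathcal C(Z,X)$, $$f\circ(x+u)=f\circ x+\sum_{k=1}^\infty\frac1{k!}f^{(k)}\circ\langle x,u,\dots,u\rangle .$$ Define $t_0f=f$, and $$t_{n+1}f\circ\langle x,u_1,\dots,u_{n+1}\rangle=d(t_nf)\circ\Big\langle (x,u_1,\dots,u_n),\big(\tfrac1{n+1}u_1,\tfrac2{n+1}u_2,\dots,\tfrac{n+1}{n+1}u_{n+1}\big)\Big\rangle ,$$ and let $T_\infty f\in\mathcal C(S_\omega X,S_\omega Y)$ be given by $\pi_n\circ T_\infty f=t_nf\circ\langle\pi_0,\dots,\pi_n\rangle$. An \emph{order $\omega$ Taylor expansion} is a functor $U$ with $UX=S_\omega X$, with $Uh=S_\omega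 h$ for $h$ a projection of a binary or countable product, a sum of coordinates $\pi_0+\pi_1:X\times X\to X$ or $\Sigma=\sum_{k}\pi_k:S_\omega X\to X$, or a homothety $r\cdot\mathrm{id}$, and for which $\pi_0:U\Rightarrow\mathrm{Id}$ and the families $\iota:\mathrm{Id}\Rightarrow U$, $\theta:U^2\Rightarrow U$, $\mathrm{sc}_r:U\Rightarrow U$, $c:U^2\Rightarrow U^2$, $l:U\Rightarrow U^2$ given by $\pi_k\iota=\delta_{k0}\mathrm{id}$, $\pi_k\theta=\sum_{i+j=k}\pi_i\pi_j$, $\pi_k\mathrm{sc}_r=r^k\pi_k$, $\pi_i\pi_jc=\pi_j\pi_i$, $\pi_i\pi_jl=\delta_{ij}\pi_i$ are natural. It is \emph{analytic} if moreover $\Sigma:U\Rightarrow\mathrm{Id}$ is natural. \textbf{Theorem.} (1) $T_\infty$ is an order $\omega$ Taylor expansion. (2) The category is Taylor if and only if $T_\infty$ is analytic. (3) Suppose moreover that $\mathcal C$ is a model of the differential $\lambda$-calculus and its Taylor expansion in the sense of Manzonetto: $\mathcal C$ is cartesian closed, currying $\Lambda$ is $R$-additive, $d$ is compatible with currying ($d(\Lambda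 f)=\Lambda\big(((e,e'),a)\mapsto df((e,a),(e',0))\big)$ for $f:E\times A\to B$), and for all $f:E\to[A\Rightarrow B]$, $g:E\to A$, $$\mathrm{ev}\circ\langle f,g\rangle=\sum_{k\ge0}\frac1{k!}\big((\cdots(\Lambda^{-}f\star g)\cdots)\star g\big)\circ\langle\mathrm{id},0\rangle\quad(k\text{ occurrences of }\star),$$ where $(h\star g)(e,a)=dh((e,a),(0,g(e)))$. Then $\mathcal C$, with all countable families summable, the objects $S_\omega X$ of summable sequences, their projections $\pi_k$ and sum $\Sigma$, and $T_\infty$, is a model of analytic coherent Taylor expansion in the sense of Ehrhard and Walch. That is, for partial countable sums of morphisms: \begin{itemize} \item hom-sets are partial $\Sigma$-monoids (unary families, partition associativity in both directions, an empty sum) and composition is left $\Sigma$-additive; product projections preserve sums and sums of pairs are computed componentwise; \item the $\pi_k$ on $S_\omega X$ are jointly monic and the $\pi_k$ and $\Sigma$ are additive; a sequence $(f_k)$ of morphisms $X\to Y$ is summable with sum $s$ iff there is $h:X\to S_\omega Y$ with $\pi_kh=f_k$ and $\Sigma h=s$; a family $(h_i)$ of morphisms $X\to S_\omega Y$ is summable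 iff $(\pi_kh_i)_{i,k}$ is; \item $T_\infty$ is a functor with $T_\infty X=S_\omega X$ acting coordinatewise on $\pi_k$, on $\Sigma$, on zero morphisms and on product projections; $\pi_0$, $\iota$, $\theta$, $c$, $l$ exist and are natural for $T_\infty$, and so is $\Sigma$. \end{itemize} -/

import Mathlib

open CategoryTheory MonoidalCategory CartesianMonoidalCategory

universe w v u

noncomputable section

namespace TaylorCat

/-! ### Complete monoids, semirings and semimodules -/

/-- Sums of all countable families in a commutative monoid (a complete monoid, for countable
index sets): they extend the finite sums, and satisfy unrestricted partition associativity. The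
fibres of `p` are the blocks of a partition of `I` (empty blocks are allowed). -/
class CountableSums (M : Type*) [AddCommMonoid M] where
  csum : ∀ {I : Type} [Countable I], (I → M) → M
  csum_empty : ∀ f : Empty → M, csum f = 0
  csum_unique : ∀ {I : Type} [Countable I] [Unique I] (f : I → M), csum f = f default
  csum_bool : ∀ f : Bool → M, csum f = f false + f true
  csum_partition : ∀ {I J : Type} [Countable I] [Countable J] (p : I → J) (f : I → M),
    csum f = csum (fun j : J => csum (fun i : {i : I // p i = j} => f i))

open CountableSums

/-- A complete commutative semiring: the product distributes over countable sums. -/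
class CompleteSemiring (R : Type w) [CommSemiring R] [CountableSums R] : Prop where
  mul_csum : ∀ {I : Type} [Countable I] (r : R) (f : I → R),
    r * csum f = csum (fun i => r * f i)

/-- Every positive integer has a multiplicative inverse in `R`. -/
def HasIntegerInverses (R : Type w) [CommSemiring R] : Prop :=
  ∀ n : ℕ, 0 < n → ∃ r : R, r * (n : R) = 1

/-- The element `1 / n` of `R` (it is unique whenever it exists). -/
def invNat (R : Type w) [CommSemiring R] (n : ℕ) : R := Ring.inverse (n : R)

/-! ### Cartesian left additive categories with countable sums -/

/-- Hom-sets are complete monoids, and `f ≫ -` preserves countable sums (hence also finite ones).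
-/
class LeftSumCategory (C : Type u) [Category.{v} C] where
  homAddCommMonoid : ∀ X Y : C, AddCommMonoid (X ⟶ Y) := by infer_instance
  homCountableSums : ∀ X Y : C, CountableSums (X ⟶ Y) := by infer_instance
  comp_csum : ∀ {X Y Z : C} {I : Type} [Countable I] (f : X ⟶ Y) (g : I → (Y ⟶ Z)),
    f ≫ csum g = csum (fun i => f ≫ g i)

attribute [reducible, instance] LeftSumCategory.homAddCommMonoid LeftSumCategory.homCountableSums

/-- A left `R`-additive category with countable sums: hom-sets are complete `R`-semimodules, and
`f ≫ -` is `R`-additive. -/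
class LeftAdditiveCategory (R : Type w) [CommSemiring R] [CountableSums R]
    (C : Type u) [Category.{v} C] [LeftSumCategory C] where
  homModule : ∀ X Y : C, Module R (X ⟶ Y) := by infer_instance
  smul_csum : ∀ {X Y : C} {I : Type} [Countable I] (r : R) (f : I → (X ⟶ Y)),
    r • csum f = csum (fun i => r • f i)
  csum_smul : ∀ {X Y : C} {I : Type} [Countable I] (r : I → R) (f : X ⟶ Y),
    csum r • f = csum (fun i => r i • f)
  comp_smul : ∀ {X Y Z : C} (f : X ⟶ Y) (r : R) (g : Y ⟶ Z), f ≫ (r • g) = r • (f ≫ g)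

attribute [reducible, instance] LeftAdditiveCategory.homModule

section

variable (R : Type w) [CommSemiring R] [CountableSums R]
variable {C : Type u} [Category.{v} C] [LeftSumCategory C] [LeftAdditiveCategory R C]

/-- `h` is `R`-additive: `- ≫ h` preserves all countable sums and the action of `R`. -/
structure IsAdditive {Y Z : C} (h : Y ⟶ Z) : Prop where
  csum_comp : ∀ {X : C} {I : Type} [Countable I] (f : I → (X ⟶ Y)),
    csum f ≫ h = csum (fun i => f i ≫ h)
  smul_comp : ∀ {X : C} (r : R) (f : X ⟶ Y), (r • f) ≫ h = r • (f ≫ h)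

end

/-- In a cartesian left `R`-additive category the projections are `R`-additive. -/
class CartesianLeftAdditive (R : Type w) [CommSemiring R] [CountableSums R]
    (C : Type u) [Category.{v} C] [CartesianMonoidalCategory C]
    [LeftSumCategory C] [LeftAdditiveCategory R C] : Prop where
  fst_additive : ∀ X Y : C, IsAdditive R (fst X Y)
  snd_additive : ∀ X Y : C, IsAdditive R (snd X Y)

/-- A derivative on a cartesian left `R`-additive category with countable sums. The first
component of `X ⊗ X` is the base point, the second one is the variation. -/
structure Derivative (R : Type w) [CommSemiring R] [CountableSums R]
    (C : Type u) [Category.{v} C] [CartesianMonoidalCategory C]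
    [LeftSumCategory C] [LeftAdditiveCategory R C] where
  d : ∀ {X Y : C}, (X ⟶ Y) → (X ⊗ X ⟶ Y)
  d_fst : ∀ X Y : C, d (fst X Y) = snd (X ⊗ Y) (X ⊗ Y) ≫ fst X Y
  d_snd : ∀ X Y : C, d (snd X Y) = snd (X ⊗ Y) (X ⊗ Y) ≫ snd X Y
  d_csum : ∀ {X Y : C} {I : Type} [Countable I] (f : I → (X ⟶ Y)),
    d (csum f) = csum (fun i => d (f i))
  d_smul : ∀ {X Y : C} (r : R) (f : X ⟶ Y), d (r • f) = r • d f
  d_id : ∀ X : C, d (𝟙 X) = snd X X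
  d_comp : ∀ {X Y Z : C} (f : X ⟶ Y) (g : Y ⟶ Z),
    d (f ≫ g) = lift (fst X X ≫ f) (d f) ≫ d g
  d_arg_csum : ∀ {X Y Z : C} {I : Type} [Countable I] (f : X ⟶ Y) (x : Z ⟶ X)
    (a : I → (Z ⟶ X)), lift x (csum a) ≫ d f = csum (fun i => lift x (a i) ≫ d f)
  d_arg_smul : ∀ {X Y Z : C} (f : X ⟶ Y) (x : Z ⟶ X) (r : R) (a : Z ⟶ X),
    lift x (r • a) ≫ d f = r • (lift x a ≫ d f)
  d_lin : ∀ {X Y Z : C} (f : X ⟶ Y) (x a : Z ⟶ X),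
    lift (lift x 0) (lift 0 a) ≫ d (d f) = lift x a ≫ d f
  d_sym : ∀ {X Y Z : C} (f : X ⟶ Y) (x a b c : Z ⟶ X),
    lift (lift x a) (lift b c) ≫ d (d f) = lift (lift x b) (lift a c) ≫ d (d f)

/-! ### Finite powers -/

section

variable {C : Type u} [Category.{v} C] [CartesianMonoidalCategory C]

/-- `S n X` is the product of `n + 1` copies of `X`, with coordinates `0, …, n`. -/
abbrev S : ℕ → C → C
  | 0, X => X
  | n + 1, X => S n X ⊗ X

/-- The tuple `⟨a 0, …, a n⟩`. -/
def tup {Z X : C} : (n : ℕ) → (Fin (n + 1) → (Z ⟶ X)) → (Z ⟶ S n X)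
  | 0, a => a 0
  | n + 1, a => lift (tup n (fun i => a i.castSucc)) (a (Fin.last (n + 1)))

/-- The projection on the coordinate `i`. -/
def pr {X : C} : (n : ℕ) → Fin (n + 1) → (S n X ⟶ X)
  | 0, _ => 𝟙 X
  | n + 1, i =>
    Fin.lastCases (motive := fun _ => (S n X ⊗ X ⟶ X))
      (snd (S n X) X) (fun j => fst (S n X) X ≫ pr n j) i

end

variable {R : Type w} [CommSemiring R] [CountableSums R]
variable {C : Type u} [Category.{v} C] [CartesianMonoidalCategory C]
variable [LeftSumCategory C] [LeftAdditiveCategory R C]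

namespace Derivative

/-- `f` is linear for the derivative. -/
def IsLinear (D : Derivative R C) {X Y : C} (f : X ⟶ Y) : Prop :=
  D.d f = snd X X ≫ f

/-- The higher order derivative `f⁽ⁿ⁾` of `f`: iterated partial derivative in the base point,
`f⁽ⁿ⁺¹⁾ (x, u₁, …, uₙ₊₁) = d f⁽ⁿ⁾ ((x, u₁, …, uₙ), (uₙ₊₁, 0, …, 0))`. -/
def hod (D : Derivative R C) {X Y : C} (f : X ⟶ Y) : (n : ℕ) → (S n X ⟶ Y)
  | 0 => f
  | n + 1 =>
    lift (fst (S n X) X) (tup n (fun i => if i = 0 then snd (S n X) X else 0)) ≫ D.d (hod D f n)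

variable (R) in
/-- `(x, u₁, …, uₙ₊₁) ↦ ((x, u₁, …, uₙ), (1/(n+1) u₁, 2/(n+1) u₂, …, (n+1)/(n+1) uₙ₊₁))`. -/
def node (X : C) (n : ℕ) : S (n + 1) X ⟶ S n X ⊗ S n X :=
  lift (tup n (fun i => pr (n + 1) i.castSucc))
    (tup n (fun i => (((i : ℕ) + 1 : ℕ) * invNat R (n + 1) : R) • pr (n + 1) i.succ))

/-- The term of order `n` of the Taylor expansion of `f`. -/
def taylorTerm (D : Derivative R C) {X Y : C} (f : X ⟶ Y) : (n : ℕ) → (S n X ⟶ Y)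
  | 0 => f
  | n + 1 => node R X n ≫ D.d (taylorTerm D f n)

/-- A cartesian differential category with countable sums is Taylor. -/
def IsTaylor (D : Derivative R C) : Prop :=
  HasIntegerInverses R ∧
  ∀ {X Y Z : C} (f : X ⟶ Y) (x a : Z ⟶ X),
    (x + a) ≫ f = x ≫ f + csum (fun k : ℕ =>
      invNat R (Nat.factorial (k + 1)) •
        (tup (k + 1) (fun i => if i = 0 then x else a) ≫ D.hod f (k + 1)))

end Derivative

/-! ### Countable powers and the infinitary Taylor expansion -/

/-- Chosen countable powers of all objects, as products in the category itself and in its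
subcategories of additive and of linear morphisms: the projections are additive and linear. -/
structure OmegaPowers (D : Derivative R C) where
  fan : ∀ X : C, Limits.Fan (fun _ : ℕ => X)
  isLimit : ∀ X : C, Limits.IsLimit (fan X)
  proj_additive : ∀ (X : C) (k : ℕ), IsAdditive R ((fan X).proj k)
  proj_linear : ∀ (X : C) (k : ℕ), D.IsLinear ((fan X).proj k)

namespace OmegaPowers

variable {D : Derivative R C} (P : OmegaPowers D)

/-- The countable power of `X`. -/
def obj (X : C) : C := (P.fan X).pt

/-- The projection on the coordinate `k`. -/
def π (X : C) (k : ℕ) : P.obj X ⟶ X := (P.fan X).proj k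

/-- The tuple `⟨a 0, a 1, …⟩`. -/
def tuple {Z X : C} (a : ℕ → (Z ⟶ X)) : Z ⟶ P.obj X :=
  Limits.Fan.IsLimit.lift (P.isLimit X) a

/-- The countable power of a morphism. -/
def map {X Y : C} (f : X ⟶ Y) : P.obj X ⟶ P.obj Y := P.tuple (fun k => P.π X k ≫ f)

/-- The first `n + 1` coordinates. -/
def trunc (X : C) (n : ℕ) : P.obj X ⟶ S n X := tup n (fun i => P.π X i)

/-- The infinitary Taylor expansion. -/
def T {X Y : C} (f : X ⟶ Y) : P.obj X ⟶ P.obj Y :=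
  P.tuple (fun n => P.trunc X n ≫ D.taylorTerm f n)

/-- The sum of all coordinates. -/
def sum (X : C) : P.obj X ⟶ X := csum (fun k : ℕ => P.π X k)

/-- `⟨id, 0, 0, …⟩` -/
def inj (X : C) : X ⟶ P.obj X := P.tuple (fun k => if k = 0 then 𝟙 X else 0)

/-- Multiplication of the coordinate `k` by `r ^ k`. -/
def scale (r : R) (X : C) : P.obj X ⟶ P.obj X := P.tuple (fun k => r ^ k • P.π X k)

/-- Multiplication of power series. -/
def mult (X : C) : P.obj (P.obj X) ⟶ P.obj X :=
  P.tuple (fun k => ∑ p ∈ Finset.HasAntidiagonal.antidiagonal k, P.π (P.obj X) p.2 ≫ P.π X p.1)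

/-- Exchange of the two indices. -/
def swap (X : C) : P.obj (P.obj X) ⟶ P.obj (P.obj X) :=
  P.tuple (fun j => P.tuple (fun i => P.π (P.obj X) i ≫ P.π X j))

/-- The diagonal inclusion. -/
def diag (X : C) : P.obj X ⟶ P.obj (P.obj X) :=
  P.tuple (fun j => P.tuple (fun i => if i = j then P.π X i else 0))

/-- `U` is (the action on morphisms of) a Taylor expansion of order `ω`. -/
structure IsTaylorExpansion (U : ∀ {X Y : C}, (X ⟶ Y) → (P.obj X ⟶ P.obj Y)) : Prop where
  map_id : ∀ X : C, U (𝟙 X) = 𝟙 (P.obj X)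
  map_comp : ∀ {X Y Z : C} (f : X ⟶ Y) (g : Y ⟶ Z), U (f ≫ g) = U f ≫ U g
  map_fst : ∀ X Y : C, U (fst X Y) = P.map (fst X Y)
  map_snd : ∀ X Y : C, U (snd X Y) = P.map (snd X Y)
  map_proj : ∀ (X : C) (k : ℕ), U (P.π X k) = P.map (P.π X k)
  map_add : ∀ X : C, U (fst X X + snd X X) = P.map (fst X X + snd X X)
  map_sum : ∀ X : C, U (P.sum X) = P.map (P.sum X)
  map_smul : ∀ (r : R) (X : C), U (r • 𝟙 X) = P.map (r • 𝟙 X)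
  proj_natural : ∀ {X Y : C} (f : X ⟶ Y), U f ≫ P.π Y 0 = P.π X 0 ≫ f
  inj_natural : ∀ {X Y : C} (f : X ⟶ Y), f ≫ P.inj Y = P.inj X ≫ U f
  mult_natural : ∀ {X Y : C} (f : X ⟶ Y), U (U f) ≫ P.mult Y = P.mult X ≫ U f
  scale_natural : ∀ (r : R) {X Y : C} (f : X ⟶ Y), U f ≫ P.scale r Y = P.scale r X ≫ U f
  swap_natural : ∀ {X Y : C} (f : X ⟶ Y), U (U f) ≫ P.swap Y = P.swap X ≫ U (U f)
  diag_natural : ∀ {X Y : C} (f : X ⟶ Y), U f ≫ P.diag Y = P.diag X ≫ U (U f)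

/-- A Taylor expansion of order `ω` is analytic if it makes the infinite sum natural. -/
structure IsAnalytic (U : ∀ {X Y : C}, (X ⟶ Y) → (P.obj X ⟶ P.obj Y)) : Prop where
  sum_natural : ∀ {X Y : C} (f : X ⟶ Y), U f ≫ P.sum Y = P.sum X ≫ f

end OmegaPowers

/-! ### Models of the differential lambda-calculus and of its Taylor expansion -/

namespace Derivative

/-- For `f : A × E ⟶ B` and `g : E ⟶ A`, the derivative of `f` in its first argument, in the
direction `g`: `(f ⋆ g) (a, e) = d f ((a, e), (g e, 0))`. -/
def star (D : Derivative R C) {A E B : C} (f : A ⊗ E ⟶ B) (g : E ⟶ A) : A ⊗ E ⟶ B :=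
  lift (𝟙 (A ⊗ E)) (lift (snd A E ≫ g) 0) ≫ D.d f

/-- A cartesian closed differential category (currying is additive and compatible with the
derivative) with countable sums that models the Taylor expansion: ordinary application is the
Taylor series of iterated differential application at `0`. -/
structure ModelsTaylorExpansion (D : Derivative R C) [MonoidalClosed C] : Prop where
  curry_csum : ∀ {A E B : C} {I : Type} [Countable I] (f : I → (A ⊗ E ⟶ B)),
    MonoidalClosed.curry (csum f) = csum (fun i => MonoidalClosed.curry (f i))
  curry_smul : ∀ {A E B : C} (r : R) (f : A ⊗ E ⟶ B),
    MonoidalClosed.curry (r • f) = r • MonoidalClosed.curry f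
  d_curry : ∀ {A E B : C} (f : A ⊗ E ⟶ B),
    D.d (MonoidalClosed.curry f) = MonoidalClosed.curry
      (lift (lift (fst A (E ⊗ E)) (snd A (E ⊗ E) ≫ fst E E))
        (lift 0 (snd A (E ⊗ E) ≫ snd E E)) ≫ D.d f)
  taylor : ∀ {A E B : C} (f : E ⟶ (ihom A).obj B) (g : E ⟶ A),
    lift g f ≫ (ihom.ev A).app B = csum (fun k : ℕ =>
      invNat R (Nat.factorial k) •
        (lift 0 (𝟙 E) ≫ (fun h => D.star h g)^[k] (MonoidalClosed.uncurry f)))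

end Derivative

/-! ### Coherent Taylor expansion -/

/-- The data of a coherent Taylor expansion, in a category whose hom-sets have partial countable
sums: `IsSum f s` says that the family `f` is summable, with sum `s`. An object `obj X` of summable
sequences of `X` comes with projections `proj X k` and a sum `sum X`; `T` is the action on morphisms
of the Taylor expansion. -/
structure CoherentTaylorData (C : Type u) [Category.{v} C] where
  IsSum : ∀ {X Y : C} {I : Type} [Countable I], (I → (X ⟶ Y)) → (X ⟶ Y) → Prop
  obj : C → C
  proj : ∀ (X : C) (_ : ℕ), obj X ⟶ X
  sum : ∀ X : C, obj X ⟶ X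
  T : ∀ {X Y : C}, (X ⟶ Y) → (obj X ⟶ obj Y)

namespace CoherentTaylorData

section

variable {C : Type u} [Category.{v} C] (E : CoherentTaylorData C)

/-- `z` is the zero morphism, that is, the empty sum. -/
def IsZero {X Y : C} (z : X ⟶ Y) : Prop := E.IsSum (fun i : Empty => i.elim) z

/-- `h` is additive for the partial sums. -/
def IsAdd {Y Z : C} (h : Y ⟶ Z) : Prop :=
  ∀ {X : C} {I : Type} [Countable I] (f : I → (X ⟶ Y)) (s : X ⟶ Y),
    E.IsSum f s → E.IsSum (fun i => f i ≫ h) (s ≫ h)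

/-- `T f` acts coordinatewise: `T f = S f`, where `S` is the functor of summable sequences. -/
def IsCoordinatewise {X Y : C} (f : X ⟶ Y) : Prop :=
  ∀ k : ℕ, E.T f ≫ E.proj Y k = E.proj X k ≫ f

end

variable {C : Type u} [Category.{v} C] [CartesianMonoidalCategory C] (E : CoherentTaylorData C)

/-- The hom-sets are `Σ`-monoids, the category is cartesian left `Σ`-additive, and the objects
`obj X` form a left `Σ`-summability structure. -/
structure IsSummability : Prop where
  isSum_unique : ∀ {X Y : C} {I : Type} [Countable I] (f : I → (X ⟶ Y)) (s t : X ⟶ Y),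
    E.IsSum f s → E.IsSum f t → s = t
  isSum_single : ∀ {X Y : C} {I : Type} [Countable I] [Unique I] (f : I → (X ⟶ Y)),
    E.IsSum f (f default)
  exists_zero : ∀ X Y : C, ∃ z : X ⟶ Y, E.IsZero z
  isSum_partition : ∀ {X Y : C} {I J : Type} [Countable I] [Countable J] (p : I → J)
    (f : I → (X ⟶ Y)) (s : X ⟶ Y),
    E.IsSum f s ↔ ∃ g : J → (X ⟶ Y),
      (∀ j, E.IsSum (fun i : {i : I // p i = j} => f i) (g j)) ∧ E.IsSum g s
  comp_isSum : ∀ {X Y Z : C} {I : Type} [Countable I] (h : X ⟶ Y) (f : I → (Y ⟶ Z)) (s : Y ⟶ Z),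
    E.IsSum f s → E.IsSum (fun i => h ≫ f i) (h ≫ s)
  isSum_lift : ∀ {X Y Z : C} {I : Type} [Countable I] (f : I → (X ⟶ Y)) (g : I → (X ⟶ Z))
    (s : X ⟶ Y) (t : X ⟶ Z),
    E.IsSum (fun i => lift (f i) (g i)) (lift s t) ↔ E.IsSum f s ∧ E.IsSum g t
  fst_add : ∀ X Y : C, E.IsAdd (fst X Y)
  snd_add : ∀ X Y : C, E.IsAdd (snd X Y)
  proj_add : ∀ (X : C) (k : ℕ), E.IsAdd (E.proj X k)
  sum_add : ∀ X : C, E.IsAdd (E.sum X)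
  proj_ext : ∀ {X Y : C} (f g : X ⟶ E.obj Y), (∀ k, f ≫ E.proj Y k = g ≫ E.proj Y k) → f = g
  isSum_nat : ∀ {X Y : C} (f : ℕ → (X ⟶ Y)) (s : X ⟶ Y),
    E.IsSum f s ↔ ∃ h : X ⟶ E.obj Y, (∀ k, h ≫ E.proj Y k = f k) ∧ h ≫ E.sum Y = s
  summable_obj : ∀ {X Y : C} {I : Type} [Countable I] (h : I → (X ⟶ E.obj Y)),
    (∃ s, E.IsSum h s) ↔ ∃ s, E.IsSum (fun q : I × ℕ => h q.1 ≫ E.proj Y q.2) s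

/-- An analytic coherent Taylor expansion. -/
structure IsAnalyticTaylorExpansion : Prop extends E.IsSummability where
  map_id : ∀ X : C, E.T (𝟙 X) = 𝟙 (E.obj X)
  map_comp : ∀ {X Y Z : C} (f : X ⟶ Y) (g : Y ⟶ Z), E.T (f ≫ g) = E.T f ≫ E.T g
  map_fst : ∀ X Y : C, E.IsCoordinatewise (fst X Y)
  map_snd : ∀ X Y : C, E.IsCoordinatewise (snd X Y)
  map_proj : ∀ (X : C) (k : ℕ), E.IsCoordinatewise (E.proj X k)
  map_sum : ∀ X : C, E.IsCoordinatewise (E.sum X)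
  map_zero : ∀ {X Y : C} (z : X ⟶ Y), E.IsZero z → E.IsCoordinatewise z
  proj_natural : ∀ {X Y : C} (f : X ⟶ Y), E.T f ≫ E.proj Y 0 = E.proj X 0 ≫ f
  inj_natural : ∃ inj : ∀ X : C, X ⟶ E.obj X,
    (∀ X, inj X ≫ E.proj X 0 = 𝟙 X ∧ ∀ k, k ≠ 0 → E.IsZero (inj X ≫ E.proj X k)) ∧
    ∀ {X Y : C} (f : X ⟶ Y), f ≫ inj Y = inj X ≫ E.T f
  mult_natural : ∃ mult : ∀ X : C, E.obj (E.obj X) ⟶ E.obj X,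
    (∀ X k, E.IsSum
      (fun p : {p : ℕ × ℕ // p.1 + p.2 = k} => E.proj (E.obj X) p.1.2 ≫ E.proj X p.1.1)
      (mult X ≫ E.proj X k)) ∧
    ∀ {X Y : C} (f : X ⟶ Y), E.T (E.T f) ≫ mult Y = mult X ≫ E.T f
  swap_natural : ∃ swap : ∀ X : C, E.obj (E.obj X) ⟶ E.obj (E.obj X),
    (∀ X i j, swap X ≫ E.proj (E.obj X) j ≫ E.proj X i = E.proj (E.obj X) i ≫ E.proj X j) ∧
    ∀ {X Y : C} (f : X ⟶ Y), E.T (E.T f) ≫ swap Y = swap X ≫ E.T (E.T f)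
  diag_natural : ∃ diag : ∀ X : C, E.obj X ⟶ E.obj (E.obj X),
    (∀ X i, diag X ≫ E.proj (E.obj X) i ≫ E.proj X i = E.proj X i) ∧
    (∀ X i j, i ≠ j → E.IsZero (diag X ≫ E.proj (E.obj X) j ≫ E.proj X i)) ∧
    ∀ {X Y : C} (f : X ⟶ Y), E.T f ≫ diag Y = diag X ≫ E.T (E.T f)
  sum_natural : ∀ {X Y : C} (f : X ⟶ Y), E.T f ≫ E.sum Y = E.sum X ≫ f

end CoherentTaylorData

/-- The infinitary Taylor expansion as the data of a coherent Taylor expansion, where all countable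
families are summable. -/
abbrev OmegaPowers.coherentData {D : Derivative R C} (P : OmegaPowers D) : CoherentTaylorData C where
  IsSum f s := csum f = s
  obj := P.obj
  proj := P.π
  sum := P.sum
  T f := P.T f

end TaylorCat

end

/-! The infinitary Taylor expansion `T f` is the solution of a differential equation. On the object
`P.obj X` of sequences in `X`, regarded as power series `x₀ + ε x₁ + ε² x₂ + ⋯`, the derivative in
`ε` is a linear vector field `P.shiftDeriv X`. The recursion for the terms of the Taylor expansion
says that `T f` commutes with these vector fields (`lie_T`), and, as the positive integers are
invertible, this property and the component `x₀ ↦ f x₀` of order `0` determine `T f` (`eq_of_lie`).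

Everything about a Taylor expansion of order `ω` follows from this uniqueness. Linear maps act
coordinatewise, and `T` is a functor. A transformation given by linear maps is natural as soon as
it relates the vector fields: for the product `θ` this is the chain rule
`d/dε x(ε, ε) = (∂₁x + ∂₂x)(ε, ε)`. Twofold expansions are controlled by the commutation of `T` with
derivatives (`T_d`), a consequence of the symmetry of second derivatives. The diagonal inclusion `l`
sends `x(ε)` to `x(ε₁ ε₂)`, and `∂₂ (x(ε₁ ε₂)) = ε₁ x'(ε₁ ε₂)`; so its naturality also needs that
`d (T f)` commutes with multiplication by `ε` in the variation (`lift_shift_d_T`).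

Differences and cancellation are not available, so that the passage from the Taylor formula to
analyticity cannot be a comparison of coefficients. It rests on two remarks.
* Commutation with `ε` implies that the sum of the coordinates of `d (T f) (x, a)` depends only on
  the sum of the coordinates of `a` (`lift_d_T_sum`). By induction on the order, the Taylor
  coefficients of any `f` therefore commute with sums of sequences of power series whose constant
  coefficients vanish, except for the first one (`dropConst_T_T_sum`).
* The power series `x` is the value at `η = ε` of the affine power series `x₀ + η (x₁ + ε x₂ + ⋯)`
  in `η`. By the naturality of `θ`, the sum of `T f` at `x` is the sum of `T f` at the affine power
  series `x₀ + η (x₁ + x₂ + ⋯)`, which is the right-hand side of the Taylor formula.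

In a model of the Taylor expansion of the differential lambda-calculus, the expansion of the
application of `λ a'. f (x + a')` to `a` is the Taylor formula for `f`. Hence `T` is analytic, and
the axioms of a coherent Taylor expansion are read off from the first two parts. -/

noncomputable section

namespace TaylorCat

open CountableSums

/-! ### Countable sums -/

section CountableSums

variable {M : Type*} [AddCommMonoid M] [CountableSums M]

theorem csum_equiv {I J : Type} [Countable I] [Countable J] (e : I ≃ J) (f : J → M) :
    csum (fun i => f (e i)) = csum f := by
  rw [csum_partition e]
  congr 1
  funext j
  let _ : Unique {i : I // e i = j} :=
    { default := ⟨e.symm j, e.apply_symm_apply j⟩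
      uniq := fun i => Subtype.ext (e.injective (by simp [i.2])) }
  rw [csum_unique]
  exact congrArg f (e.apply_symm_apply j)

theorem csum_of_isEmpty {I : Type} [Countable I] [IsEmpty I] (f : I → M) : csum f = 0 := by
  rw [← csum_equiv (Equiv.equivOfIsEmpty Empty I) f, csum_empty]

theorem csum_zero (I : Type) [Countable I] : csum (fun _ : I => (0 : M)) = 0 := by
  have h := csum_partition (M := M) (fun i : Empty => (i.elim : I)) (fun i => i.elim)
  rw [csum_empty] at h
  refine Eq.trans ?_ h.symm
  congr 1
  funext j
  have : IsEmpty {i : Empty // (i.elim : I) = j} := ⟨fun i => i.1.elim⟩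
  rw [csum_of_isEmpty]

theorem csum_option {I : Type} [Countable I] (f : Option I → M) :
    csum f = f none + csum (fun i => f (some i)) := by
  rw [csum_partition (fun o : Option I => o.isSome) f, csum_bool]
  congr 1
  · let _ : Unique {o : Option I // o.isSome = false} :=
      { default := ⟨none, rfl⟩
        uniq := fun o => Subtype.ext (by simpa using o.2) }
    rw [csum_unique]
    rfl
  · let e : I ≃ {o : Option I // o.isSome = true} :=
      { toFun := fun i => ⟨some i, rfl⟩
        invFun := fun o => o.1.get o.2
        left_inv := fun i => rfl
        right_inv := fun o => Subtype.ext (Option.some_get o.2) }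
    rw [← csum_equiv e]
    rfl

theorem csum_nat_succ (f : ℕ → M) : csum f = f 0 + csum (fun n => f (n + 1)) := by
  let e : Option ℕ ≃ ℕ :=
    { toFun := fun o => o.elim 0 Nat.succ
      invFun := fun n => Nat.casesOn n none some
      left_inv := fun o => by cases o <;> rfl
      right_inv := fun n => by cases n <;> rfl }
  rw [← csum_equiv e, csum_option]
  rfl

theorem csum_fintype {I : Type} [Fintype I] (f : I → M) : csum f = ∑ i, f i := by
  have hfin : ∀ (n : ℕ) (f : Fin n → M), csum f = ∑ i, f i := by
    intro n
    induction n with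
    | zero => intro f; rw [csum_of_isEmpty, Finset.univ_eq_empty, Finset.sum_empty]
    | succ n ih =>
      intro f
      rw [← csum_equiv (finSuccEquiv n).symm, csum_option, ih, Fin.sum_univ_succ]
      simp
  rw [← csum_equiv (Fintype.equivFin I).symm, hfin, Equiv.sum_comp]

theorem csum_finset {ι : Type} (s : Finset ι) (f : ι → M) :
    csum (fun i : {i // i ∈ s} => f i) = ∑ i ∈ s, f i := by
  rw [csum_fintype, Finset.sum_coe_sort s f]

theorem csum_sigma {I J : Type} [Countable I] [Countable J] (f : I → J → M) :
    csum (fun i => csum (f i)) = csum (fun q : I × J => f q.1 q.2) := by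
  rw [csum_partition (fun q : I × J => q.1)]
  congr 1
  funext i
  let e : J ≃ {q : I × J // q.1 = i} :=
    { toFun := fun j => ⟨(i, j), rfl⟩
      invFun := fun q => q.1.2
      left_inv := fun j => rfl
      right_inv := fun q => Subtype.ext (Prod.ext q.2.symm rfl) }
  rw [← csum_equiv e]
  rfl

theorem csum_comm {I J : Type} [Countable I] [Countable J] (f : I → J → M) :
    csum (fun i => csum (f i)) = csum (fun j => csum (fun i => f i j)) := by
  rw [csum_sigma, csum_sigma, ← csum_equiv (Equiv.prodComm J I)]
  rfl

/-- Summing along the antidiagonals. -/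
theorem csum_antidiagonal (f : ℕ → ℕ → M) :
    csum (fun k => ∑ p ∈ Finset.HasAntidiagonal.antidiagonal k, f p.2 p.1) =
      csum (fun i => csum (f i)) := by
  rw [csum_comm, csum_sigma, csum_partition (fun q : ℕ × ℕ => q.1 + q.2)]
  congr 1
  funext k
  rw [← csum_finset]
  let e : {p : ℕ × ℕ // p ∈ Finset.HasAntidiagonal.antidiagonal k} ≃
      {q : ℕ × ℕ // q.1 + q.2 = k} := Equiv.subtypeEquivRight (by simp)
  rw [← csum_equiv e]
  rfl

theorem csum_ite_eq {I : Type} [Countable I] [DecidableEq I] (j : I) (f : I → M) :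
    csum (fun i => if i = j then f i else 0) = f j := by
  rw [csum_partition (fun i => (decide (i = j))), csum_bool]
  have h : csum (fun i : {i // decide (i = j) = false} => if i.1 = j then f i else 0) = 0 :=
    Eq.trans (congrArg _ (funext fun i => if_neg (by simpa using i.2))) (csum_zero _)
  let _ : Unique {i : I // decide (i = j) = true} :=
    { default := ⟨j, by simp⟩
      uniq := fun o => Subtype.ext (by simpa using o.2) }
  rw [h, csum_unique, zero_add]
  exact if_pos rfl

end CountableSums

/-! ### Finite sums of morphisms -/

section LeftSum

variable {C : Type u} [Category.{v} C] [LeftSumCategory C]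

@[simp]
theorem comp_zero {X Y Z : C} (f : X ⟶ Y) : f ≫ (0 : Y ⟶ Z) = 0 := by
  rw [← csum_empty (fun i : Empty => i.elim), LeftSumCategory.comp_csum, csum_of_isEmpty]

@[simp]
theorem comp_add {X Y Z : C} (f : X ⟶ Y) (g h : Y ⟶ Z) : f ≫ (g + h) = f ≫ g + f ≫ h := by
  have := LeftSumCategory.comp_csum f (fun b : Bool => bif b then h else g)
  rwa [csum_bool, csum_bool] at this

theorem comp_finset_sum {X Y Z : C} {ι : Type} (s : Finset ι) (f : X ⟶ Y) (g : ι → (Y ⟶ Z)) :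
    f ≫ ∑ i ∈ s, g i = ∑ i ∈ s, f ≫ g i := by
  rw [← csum_finset, LeftSumCategory.comp_csum, csum_finset s (fun i => f ≫ g i)]

end LeftSum

section Linear

variable {R : Type w} [CommSemiring R] [CountableSums R]
variable {C : Type u} [Category.{v} C] [CartesianMonoidalCategory C]
variable [LeftSumCategory C] [LeftAdditiveCategory R C]

attribute [simp] LeftAdditiveCategory.comp_smul

namespace Derivative

/-! ### Linear morphisms -/

section

variable {D : Derivative R C}

theorem IsLinear.d_eq {X Y : C} {h : X ⟶ Y} (hh : D.IsLinear h) : D.d h = snd X X ≫ h := hh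

theorem isLinear_fst (D : Derivative R C) (X Y : C) : D.IsLinear (fst X Y) := D.d_fst X Y

theorem isLinear_snd (D : Derivative R C) (X Y : C) : D.IsLinear (snd X Y) := D.d_snd X Y

theorem isLinear_id (D : Derivative R C) (X : C) : D.IsLinear (𝟙 X) := by
  rw [IsLinear, D.d_id, Category.comp_id]

theorem isLinear_csum {X Y : C} {I : Type} [Countable I] {f : I → (X ⟶ Y)}
    (hf : ∀ i, D.IsLinear (f i)) : D.IsLinear (csum f) := by
  rw [IsLinear, D.d_csum, LeftSumCategory.comp_csum]
  exact congrArg _ (funext hf)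

theorem isLinear_zero (D : Derivative R C) (X Y : C) : D.IsLinear (0 : X ⟶ Y) := by
  rw [← csum_empty (fun i : Empty => i.elim)]
  exact isLinear_csum fun i => i.elim

theorem isLinear_sum {X Y : C} {ι : Type} (s : Finset ι) {f : ι → (X ⟶ Y)}
    (hf : ∀ i, D.IsLinear (f i)) : D.IsLinear (∑ i ∈ s, f i) := by
  rw [← csum_finset]
  exact isLinear_csum fun i => hf i

namespace IsLinear

theorem add {X Y : C} {f g : X ⟶ Y} (hf : D.IsLinear f) (hg : D.IsLinear g) :
    D.IsLinear (f + g) := by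
  have := isLinear_csum (D := D) (f := fun b : Bool => bif b then g else f)
    (by rintro (_ | _) <;> assumption)
  rwa [csum_bool] at this

theorem smul {X Y : C} (r : R) {f : X ⟶ Y} (hf : D.IsLinear f) : D.IsLinear (r • f) := by
  rw [IsLinear, D.d_smul, hf.d_eq, LeftAdditiveCategory.comp_smul]

theorem comp {X Y Z : C} {f : X ⟶ Y} {g : Y ⟶ Z} (hf : D.IsLinear f) (hg : D.IsLinear g) :
    D.IsLinear (f ≫ g) := by
  rw [IsLinear, D.d_comp, hg.d_eq, lift_snd_assoc, hf.d_eq, Category.assoc]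

variable {X Y Z : C} {h : Y ⟶ Z}

/-- The derivative of a composite with an outer linear morphism. -/
theorem d_comp (hh : D.IsLinear h) (f : X ⟶ Y) : D.d (f ≫ h) = D.d f ≫ h := by
  rw [D.d_comp, hh.d_eq, lift_snd_assoc]

/-- Linear morphisms are additive, because derivatives are additive in the variation. -/
theorem csum_comp (hh : D.IsLinear h) {I : Type} [Countable I] (f : I → (X ⟶ Y)) :
    csum f ≫ h = csum (fun i => f i ≫ h) := by
  have := D.d_arg_csum h 0 f
  simpa only [hh.d_eq, lift_snd_assoc] using this

theorem smul_comp (hh : D.IsLinear h) (r : R) (f : X ⟶ Y) : (r • f) ≫ h = r • (f ≫ h) := by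
  have := D.d_arg_smul h 0 r f
  simpa only [hh.d_eq, lift_snd_assoc] using this

theorem zero_comp (hh : D.IsLinear h) : (0 : X ⟶ Y) ≫ h = 0 := by
  have := hh.csum_comp (fun i : Empty => (i.elim : X ⟶ Y))
  rwa [csum_empty, csum_empty] at this

theorem add_comp (hh : D.IsLinear h) (f g : X ⟶ Y) : (f + g) ≫ h = f ≫ h + g ≫ h := by
  have := hh.csum_comp (fun b : Bool => bif b then g else f)
  rwa [csum_bool, csum_bool] at this

end IsLinear

theorem d_lift (D : Derivative R C) {X Y Z : C} (f : X ⟶ Y) (g : X ⟶ Z) :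
    D.d (lift f g) = lift (D.d f) (D.d g) := by
  apply CartesianMonoidalCategory.hom_ext
  · rw [← (D.isLinear_fst Y Z).d_comp, lift_fst, lift_fst]
  · rw [← (D.isLinear_snd Y Z).d_comp, lift_snd, lift_snd]

theorem IsLinear.lift {X Y Z : C} {f : X ⟶ Y} {g : X ⟶ Z} (hf : D.IsLinear f)
    (hg : D.IsLinear g) : D.IsLinear (lift f g) := by
  rw [IsLinear, D.d_lift, hf.d_eq, hg.d_eq, comp_lift]

theorem lift_csum (D : Derivative R C) {X Y Z : C} {I : Type} [Countable I] (f : I → (X ⟶ Y))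
    (g : I → (X ⟶ Z)) : lift (csum f) (csum g) =
      csum (fun i => lift (f i) (g i)) := by
  apply CartesianMonoidalCategory.hom_ext
  · simp only [lift_fst, (D.isLinear_fst Y Z).csum_comp]
  · simp only [lift_snd, (D.isLinear_snd Y Z).csum_comp]

theorem lift_add (D : Derivative R C) {X Y Z : C} (f f' : X ⟶ Y) (g g' : X ⟶ Z) :
    lift (f + f') (g + g') =
      lift f g + lift f' g' := by
  apply CartesianMonoidalCategory.hom_ext
  · simp only [lift_fst, (D.isLinear_fst Y Z).add_comp]
  · simp only [lift_snd, (D.isLinear_snd Y Z).add_comp]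

theorem lift_zero (D : Derivative R C) (X Y Z : C) :
    lift (0 : X ⟶ Y) (0 : X ⟶ Z) = 0 := by
  apply CartesianMonoidalCategory.hom_ext
  · rw [lift_fst, (D.isLinear_fst Y Z).zero_comp]
  · rw [lift_snd, (D.isLinear_snd Y Z).zero_comp]

theorem d_arg_zero (D : Derivative R C) {X Y Z : C} (f : X ⟶ Y) (x : Z ⟶ X) :
    lift x 0 ≫ D.d f = 0 := by
  have := D.d_arg_csum f x (fun i : Empty => i.elim)
  rwa [csum_empty, csum_empty] at this

theorem d_arg_add (D : Derivative R C) {X Y Z : C} (f : X ⟶ Y) (x a b : Z ⟶ X) :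
    lift x (a + b) ≫ D.d f =
      lift x a ≫ D.d f + lift x b ≫ D.d f := by
  have := D.d_arg_csum f x (fun i : Bool => bif i then b else a)
  rwa [csum_bool, csum_bool] at this

/-- The second derivative in a direction which does not move the base point. -/
theorem d_d_zero (D : Derivative R C) {X Y Z : C} (f : X ⟶ Y) (x a b : Z ⟶ X) :
    lift (lift x a)
      (lift 0 b) ≫ D.d (D.d f) =
      lift x b ≫ D.d f := by
  have h : lift a b = lift a 0 +
      lift 0 b := by
    rw [← D.lift_add, add_zero, zero_add]
  rw [D.d_sym, h, d_arg_add, D.d_lin, D.d_sym, D.lift_zero, d_arg_zero, zero_add]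

/-! ### Derivatives along a vector field -/

/-- The derivative of `f` along the vector field `ξ`, that is, `x ↦ d f (x, ξ x)`. -/
def lie (D : Derivative R C) {X Y : C} (ξ : X ⟶ X) (f : X ⟶ Y) : X ⟶ Y :=
  lift (𝟙 X) ξ ≫ D.d f

section Lie

variable {X Y Z : C}

theorem comp_lie (D : Derivative R C) (ξ : X ⟶ X) (f : X ⟶ Y) (x : Z ⟶ X) :
    x ≫ D.lie ξ f = lift x (x ≫ ξ) ≫ D.d f := by
  rw [lie, comp_lift_assoc, Category.comp_id]

theorem lie_comp (D : Derivative R C) (ξ : X ⟶ X) (f : X ⟶ Y) (g : Y ⟶ Z) :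
    D.lie ξ (f ≫ g) = lift f (D.lie ξ f) ≫ D.d g := by
  rw [lie, D.d_comp, comp_lift_assoc, lift_fst_assoc, Category.id_comp, ← lie]

/-- The derivative along related vector fields. -/
theorem lie_comp_of_related (D : Derivative R C) {ξ : X ⟶ X} {η : Y ⟶ Y} {f : X ⟶ Y}
    (h : D.lie ξ f = f ≫ η) (g : Y ⟶ Z) : D.lie ξ (f ≫ g) = f ≫ D.lie η g := by
  rw [lie_comp, comp_lie, h]

theorem IsLinear.lie_eq {f : X ⟶ Y} (hf : D.IsLinear f) (ξ : X ⟶ X) : D.lie ξ f = ξ ≫ f := by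
  rw [lie, hf.d_eq, lift_snd_assoc]

theorem IsLinear.lie_comp {g : Y ⟶ Z} (hg : D.IsLinear g) (ξ : X ⟶ X) (f : X ⟶ Y) :
    D.lie ξ (f ≫ g) = D.lie ξ f ≫ g := by
  rw [lie, hg.d_comp, lie, Category.assoc]

theorem lie_zero (D : Derivative R C) (f : X ⟶ Y) : D.lie 0 f = 0 := D.d_arg_zero f _

theorem lie_add (D : Derivative R C) (ξ η : X ⟶ X) (f : X ⟶ Y) :
    D.lie (ξ + η) f = D.lie ξ f + D.lie η f := D.d_arg_add f _ _ _

theorem smul_lie (D : Derivative R C) (r : R) (ξ : X ⟶ X) (f : X ⟶ Y) :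
    D.lie (r • ξ) f = r • D.lie ξ f := D.d_arg_smul f _ _ _

theorem lie_smul (D : Derivative R C) (r : R) (ξ : X ⟶ X) (f : X ⟶ Y) :
    D.lie ξ (r • f) = r • D.lie ξ f := by
  rw [lie, D.d_smul, LeftAdditiveCategory.comp_smul, lie]

/-- Differentiating along a linear vector field commutes with the derivative. -/
theorem d_lie (D : Derivative R C) {ξ : X ⟶ X} (hξ : D.IsLinear ξ) (f : X ⟶ Y) :
    D.d (D.lie ξ f) =
      D.lie (lift (fst X X ≫ ξ) (snd X X ≫ ξ)) (D.d f) := by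
  rw [lie, D.d_comp, ((D.isLinear_id X).lift hξ).d_eq, comp_lift, comp_lift, Category.comp_id,
    Category.comp_id, D.d_sym, lift_fst_snd, lie]

end Lie

end
end Derivative
end Linear

/-! ### Division by positive integers -/

section Division

variable {R : Type w} [CommSemiring R]

theorem invNat_mul (hR : HasIntegerInverses R) {n : ℕ} (hn : 0 < n) :
    invNat R n * (n : R) = 1 := by
  obtain ⟨r, hr⟩ := hR n hn
  exact Ring.inverse_mul_cancel _ (IsUnit.of_mul_eq_one_right r hr)

theorem eq_invNat_smul (hR : HasIntegerInverses R) {M : Type*} [AddCommMonoid M] [Module R M]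
    {n : ℕ} (hn : 0 < n) {a b : M} (h : (n : R) • a = b) : a = invNat R n • b := by
  rw [← h, smul_smul, invNat_mul hR hn, one_smul]

theorem smul_cancel_nat (hR : HasIntegerInverses R) {M : Type*} [AddCommMonoid M] [Module R M]
    {n : ℕ} (hn : 0 < n) {a b : M} (h : (n : R) • a = (n : R) • b) : a = b := by
  rw [eq_invNat_smul hR hn h, smul_smul, invNat_mul hR hn, one_smul]

theorem csum_factorial_smul (hR : HasIntegerInverses R) {M : Type*} [AddCommMonoid M]
    [CountableSums M] [Module R M] (F : ℕ → M) :
    csum (fun k : ℕ => invNat R k.factorial • F k) =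
      F 0 + csum (fun k : ℕ => invNat R (k + 1).factorial • F (k + 1)) := by
  have h := invNat_mul hR Nat.one_pos
  rw [Nat.cast_one, mul_one] at h
  rw [csum_nat_succ, Nat.factorial_zero, h, one_smul]

end Division

/-! ### Tuples -/

section Tuples

variable {C : Type u} [Category.{v} C] [CartesianMonoidalCategory C] {W X Y Z : C}

theorem comp_tup (z : W ⟶ Z) : ∀ (n : ℕ) (a : Fin (n + 1) → (Z ⟶ X)),
    z ≫ tup n a = tup n (fun i => z ≫ a i)
  | 0, _ => rfl
  | n + 1, a => by
    rw [tup, comp_lift, comp_tup z n]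
    rfl

theorem tup_pr : ∀ (n : ℕ) (a : Fin (n + 1) → (Z ⟶ X)) (i : Fin (n + 1)), tup n a ≫ pr n i = a i
  | 0, a, i => by
    obtain rfl : i = 0 := Fin.fin_one_eq_zero i
    exact Category.comp_id _
  | n + 1, a, i => by
    induction i using Fin.lastCases with
    | last =>
      simp only [tup, pr, Fin.lastCases_last]
      exact lift_snd _ _
    | cast j =>
      simp only [tup, pr, Fin.lastCases_castSucc]
      erw [lift_fst_assoc]
      exact tup_pr n _ j

variable {R : Type w} [CommSemiring R] [CountableSums R]
variable [LeftSumCategory C] [LeftAdditiveCategory R C] {D : Derivative R C}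

theorem isLinear_tup : ∀ (n : ℕ) {a : Fin (n + 1) → (Z ⟶ X)}, (∀ i, D.IsLinear (a i)) →
    D.IsLinear (tup n a)
  | 0, _, h => h 0
  | n + 1, _, h => (isLinear_tup n fun i => h i.castSucc).lift (h (Fin.last (n + 1)))

theorem tup_smul (D : Derivative R C) (r : R) : ∀ (n : ℕ) (a : Fin (n + 1) → (Z ⟶ X)),
    tup n (fun i => r • a i) = r • tup n a
  | 0, _ => rfl
  | n + 1, a => by
    rw [tup, tup, tup_smul D r n]
    apply CartesianMonoidalCategory.hom_ext
    · rw [lift_fst, (D.isLinear_fst _ _).smul_comp, lift_fst]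
    · rw [lift_snd, (D.isLinear_snd _ _).smul_comp, lift_snd]

end Tuples

/-! ### Countable powers -/

namespace OmegaPowers

variable {R : Type w} [CommSemiring R] [CountableSums R]
variable {C : Type u} [Category.{v} C] [CartesianMonoidalCategory C]
variable [LeftSumCategory C] [LeftAdditiveCategory R C]
variable {D : Derivative R C} (P : OmegaPowers D)
variable {W X Y Z : C}

@[simp]
theorem tuple_π (a : ℕ → (Z ⟶ X)) (k : ℕ) : P.tuple a ≫ P.π X k = a k :=
  Limits.Fan.IsLimit.fac (P.isLimit X) a k

@[simp]
theorem tuple_π_assoc (a : ℕ → (Z ⟶ X)) (k : ℕ) (f : X ⟶ Y) :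
    P.tuple a ≫ P.π X k ≫ f = a k ≫ f := by
  rw [← Category.assoc, tuple_π]

theorem hom_ext {f g : Z ⟶ P.obj X} (h : ∀ k, f ≫ P.π X k = g ≫ P.π X k) : f = g :=
  Limits.Fan.IsLimit.hom_ext (P.isLimit X) f g h

theorem isLinear_π (X : C) (k : ℕ) : D.IsLinear (P.π X k) := P.proj_linear X k

theorem d_tuple (a : ℕ → (X ⟶ Y)) : D.d (P.tuple a) = P.tuple (fun k => D.d (a k)) := by
  refine P.hom_ext fun k => ?_
  rw [← (P.isLinear_π Y k).d_comp, tuple_π, tuple_π]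

theorem isLinear_tuple {a : ℕ → (X ⟶ Y)} (ha : ∀ k, D.IsLinear (a k)) :
    D.IsLinear (P.tuple a) := by
  refine P.hom_ext fun k => ?_
  rw [d_tuple, tuple_π, Category.assoc, tuple_π, (ha k).d_eq]

@[simp]
theorem map_π (f : X ⟶ Y) (k : ℕ) : P.map f ≫ P.π Y k = P.π X k ≫ f := P.tuple_π _ k

@[simp]
theorem map_π_assoc (f : X ⟶ Y) (k : ℕ) (g : Y ⟶ Z) :
    P.map f ≫ P.π Y k ≫ g = P.π X k ≫ f ≫ g := P.tuple_π_assoc _ k g |>.trans (by simp)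

theorem map_id (X : C) : P.map (𝟙 X) = 𝟙 (P.obj X) := P.hom_ext fun k => by simp

theorem isLinear_map {f : X ⟶ Y} (hf : D.IsLinear f) : D.IsLinear (P.map f) :=
  P.isLinear_tuple fun k => (P.isLinear_π X k).comp hf

/-! ### The derivative of power series -/

/-- The derivative of power series: `(xₖ)ₖ ↦ ((k + 1) xₖ₊₁)ₖ`, seen as a vector field. -/
def shiftDeriv (X : C) : P.obj X ⟶ P.obj X :=
  P.tuple (fun k => ((k + 1 : ℕ) : R) • P.π X (k + 1))

theorem shiftDeriv_π (X : C) (k : ℕ) :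
    P.shiftDeriv X ≫ P.π X k = ((k + 1 : ℕ) : R) • P.π X (k + 1) := P.tuple_π _ k

theorem isLinear_shiftDeriv (X : C) : D.IsLinear (P.shiftDeriv X) :=
  P.isLinear_tuple fun _ => (P.isLinear_π X _).smul _

theorem map_shiftDeriv {h : X ⟶ Y} (hh : D.IsLinear h) :
    P.map h ≫ P.shiftDeriv Y = P.shiftDeriv X ≫ P.map h := by
  refine P.hom_ext fun k => ?_
  simp only [Category.assoc, shiftDeriv_π, map_π, LeftAdditiveCategory.comp_smul]
  rw [← Category.assoc, shiftDeriv_π, hh.smul_comp]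

/-- Sequences are determined by their derivative and their initial value; the coordinates of the
derivative may be compared under the assumption that the sequences agree at the same index. -/
theorem eq_of_shiftDeriv (hR : HasIntegerInverses R) {h h' : Z ⟶ P.obj X}
    (h0 : h ≫ P.π X 0 = h' ≫ P.π X 0)
    (hs : ∀ n, h ≫ P.π X n = h' ≫ P.π X n →
      h ≫ P.shiftDeriv X ≫ P.π X n = h' ≫ P.shiftDeriv X ≫ P.π X n) : h = h' := by
  refine P.hom_ext fun n => ?_
  induction n with
  | zero => exact h0
  | succ n ih =>
    have := hs n ih
    rw [shiftDeriv_π, LeftAdditiveCategory.comp_smul, LeftAdditiveCategory.comp_smul] at this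
    exact smul_cancel_nat hR n.succ_pos this

/-- Uniqueness for the differential equation `dh/dε = L_ξ h + e`. -/
theorem eq_of_lie_add (hR : HasIntegerInverses R) {h h' : Z ⟶ P.obj X} (ξ : Z ⟶ Z)
    (e : Z ⟶ P.obj X)
    (h0 : h ≫ P.π X 0 = h' ≫ P.π X 0) (hh : h ≫ P.shiftDeriv X = D.lie ξ h + e)
    (hh' : h' ≫ P.shiftDeriv X = D.lie ξ h' + e) : h = h' := by
  refine P.eq_of_shiftDeriv hR h0 fun n hn => ?_
  have hπ := P.isLinear_π X n
  rw [← Category.assoc, hh, hπ.add_comp, ← hπ.lie_comp, hn, ← Category.assoc, hh', hπ.add_comp,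
    ← hπ.lie_comp]

/-- A sequence of morphisms which solves `dh/dε = L_ξ h` is determined by its initial value. -/
theorem eq_of_lie (hR : HasIntegerInverses R) {h h' : Z ⟶ P.obj X} (ξ : Z ⟶ Z)
    (h0 : h ≫ P.π X 0 = h' ≫ P.π X 0) (hh : D.lie ξ h = h ≫ P.shiftDeriv X)
    (hh' : D.lie ξ h' = h' ≫ P.shiftDeriv X) : h = h' :=
  P.eq_of_lie_add hR ξ 0 h0 (by rw [hh, add_zero]) (by rw [hh', add_zero])

/-! ### The differential equation of the Taylor expansion -/

theorem T_π (f : X ⟶ Y) (n : ℕ) : P.T f ≫ P.π Y n = P.trunc X n ≫ D.taylorTerm f n :=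
  P.tuple_π _ n

@[simp]
theorem T_π_zero (f : X ⟶ Y) : P.T f ≫ P.π Y 0 = P.π X 0 ≫ f := P.T_π f 0

@[simp]
theorem T_π_zero_assoc (f : X ⟶ Y) (g : Y ⟶ Z) : P.T f ≫ P.π Y 0 ≫ g = P.π X 0 ≫ f ≫ g := by
  rw [← Category.assoc, T_π_zero, Category.assoc]

theorem isLinear_trunc (X : C) (n : ℕ) : D.IsLinear (P.trunc X n) :=
  isLinear_tup n fun _ => P.isLinear_π X _

theorem trunc_node (X : C) (n : ℕ) : P.trunc X (n + 1) ≫ Derivative.node R X n =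
    lift (P.trunc X n) (invNat R (n + 1) • (P.shiftDeriv X ≫ P.trunc X n)) := by
  have h : P.shiftDeriv X ≫ P.trunc X n = tup n (fun i => P.shiftDeriv X ≫ P.π X i) :=
    comp_tup _ _ _
  rw [h, Derivative.node, comp_lift, comp_tup, comp_tup, ← tup_smul D]
  congr 2
  · funext i
    rw [trunc, tup_pr]
    rfl
  · funext i
    rw [trunc, LeftAdditiveCategory.comp_smul, tup_pr, shiftDeriv_π, smul_smul, mul_comm]
    rfl

theorem lie_T_π (hR : HasIntegerInverses R) (f : X ⟶ Y) (n : ℕ) :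
    D.lie (P.shiftDeriv X) (P.T f ≫ P.π Y n) = ((n + 1 : ℕ) : R) • (P.T f ≫ P.π Y (n + 1)) := by
  rw [T_π, T_π, D.lie_comp, (P.isLinear_trunc X n).lie_eq, Derivative.taylorTerm,
    ← Category.assoc (P.trunc X (n + 1)), trunc_node, D.d_arg_smul, smul_smul, mul_comm,
    invNat_mul hR n.succ_pos, one_smul]

/-- The Taylor expansion of `f` commutes with the derivative of power series; together with its
component of order `0`, this characterizes it. -/
theorem lie_T (hR : HasIntegerInverses R) (f : X ⟶ Y) :
    D.lie (P.shiftDeriv X) (P.T f) = P.T f ≫ P.shiftDeriv Y := by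
  refine P.hom_ext fun n => ?_
  rw [← (P.isLinear_π Y n).lie_comp, P.lie_T_π hR, Category.assoc, shiftDeriv_π,
    LeftAdditiveCategory.comp_smul]

theorem T_eq_map (hR : HasIntegerInverses R) {h : X ⟶ Y} (hh : D.IsLinear h) :
    P.T h = P.map h :=
  P.eq_of_lie hR (P.shiftDeriv X) (by simp) (P.lie_T hR h)
    (by rw [(P.isLinear_map hh).lie_eq, P.map_shiftDeriv hh])

theorem T_id (hR : HasIntegerInverses R) (X : C) : P.T (𝟙 X) = 𝟙 (P.obj X) := by
  rw [P.T_eq_map hR (D.isLinear_id X), map_id]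

theorem T_comp (hR : HasIntegerInverses R) (f : X ⟶ Y) (g : Y ⟶ Z) :
    P.T (f ≫ g) = P.T f ≫ P.T g :=
  P.eq_of_lie hR (P.shiftDeriv X) (by simp) (P.lie_T hR _)
    (by rw [D.lie_comp_of_related (P.lie_T hR f), P.lie_T hR g, Category.assoc])

theorem T_comp_linear (hR : HasIntegerInverses R) (f : X ⟶ Y) {h : Y ⟶ Z} (hh : D.IsLinear h) :
    P.T (f ≫ h) = P.T f ≫ P.map h := by
  rw [P.T_comp hR, P.T_eq_map hR hh]

theorem T_linear_comp (hR : HasIntegerInverses R) {h : X ⟶ Y} (hh : D.IsLinear h) (f : Y ⟶ Z) :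
    P.T (h ≫ f) = P.map h ≫ P.T f := by
  rw [P.T_comp hR, P.T_eq_map hR hh]

/-- If `α` is linear and relates the vector field `ξ` to the derivative of power series, then so
does `α ≫ T f`: one half of each proof of naturality by `eq_of_lie`. -/
theorem lie_comp_T (hR : HasIntegerInverses R) {ξ : Z ⟶ Z} {α : Z ⟶ P.obj X}
    (hα : D.IsLinear α) (h : α ≫ P.shiftDeriv X = ξ ≫ α) (f : X ⟶ Y) :
    D.lie ξ (α ≫ P.T f) = (α ≫ P.T f) ≫ P.shiftDeriv Y := by
  rw [D.lie_comp_of_related (by rw [hα.lie_eq, h]), P.lie_T hR, Category.assoc]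

/-! ### Taylor expansion of derivatives -/

/-- Taylor expansion commutes with derivatives, up to the exchange of countable and binary
products. -/
theorem T_d (hR : HasIntegerInverses R) (f : X ⟶ Y) :
    P.T (D.d f) = lift (P.map (fst X X)) (P.map (snd X X)) ≫ D.d (P.T f) := by
  have hf := D.isLinear_fst X X
  have hs := D.isLinear_snd X X
  have hα : D.IsLinear (lift (P.map (fst X X)) (P.map (snd X X))) :=
    (P.isLinear_map hf).lift (P.isLinear_map hs)
  have hσ := P.isLinear_shiftDeriv X
  refine P.eq_of_lie hR (P.shiftDeriv (X ⊗ X)) ?_ (P.lie_T hR _) ?_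
  · have h := D.d_comp (P.π X 0) f
    rw [(P.isLinear_π X 0).d_eq] at h
    rw [T_π_zero, Category.assoc, ← (P.isLinear_π Y 0).d_comp, T_π_zero, h, comp_lift_assoc,
      lift_fst_assoc, lift_snd_assoc, map_π, map_π, ← comp_lift, lift_fst_snd, Category.comp_id]
  · have h : D.d (P.T f) ≫ P.shiftDeriv Y = D.lie
        (lift (fst _ _ ≫ P.shiftDeriv X) (snd _ _ ≫ P.shiftDeriv X)) (D.d (P.T f)) := by
      rw [← D.d_lie hσ, P.lie_T hR, (P.isLinear_shiftDeriv Y).d_comp]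
    rw [Category.assoc, h]
    refine D.lie_comp_of_related ?_ _
    rw [hα.lie_eq, comp_lift, comp_lift, lift_fst_assoc, lift_snd_assoc, P.map_shiftDeriv hf,
      P.map_shiftDeriv hs]

theorem T_lift_d (hR : HasIntegerInverses R) (x a : Z ⟶ X) (f : X ⟶ Y) :
    P.T (lift x a ≫ D.d f) = lift (P.T x) (P.T a) ≫ D.d (P.T f) := by
  rw [P.T_comp hR, T_d P hR, comp_lift_assoc, ← P.T_comp_linear hR _ (D.isLinear_fst X X),
    ← P.T_comp_linear hR _ (D.isLinear_snd X X), lift_fst, lift_snd]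

/-- The Taylor expansion of a derivative along a linear vector field. -/
theorem T_lie (hR : HasIntegerInverses R) {ξ : X ⟶ X} (hξ : D.IsLinear ξ) (f : X ⟶ Y) :
    P.T (D.lie ξ f) = D.lie (P.map ξ) (P.T f) := by
  rw [Derivative.lie, P.T_lift_d hR, P.T_id hR, P.T_eq_map hR hξ, Derivative.lie]

/-- The inner derivative of power series commutes with twofold Taylor expansions. -/
theorem lie_map_T_T (hR : HasIntegerInverses R) (f : X ⟶ Y) :
    D.lie (P.map (P.shiftDeriv X)) (P.T (P.T f)) = P.T (P.T f) ≫ P.map (P.shiftDeriv Y) := by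
  rw [← P.T_lie hR (P.isLinear_shiftDeriv X), P.lie_T hR,
    P.T_comp_linear hR _ (P.isLinear_shiftDeriv Y)]

/-! ### Multiplication of power series by the indeterminate -/

/-- Multiplication of a power series by the indeterminate: `(x₀, x₁, …) ↦ (0, x₀, x₁, …)`. -/
def shift (X : C) : P.obj X ⟶ P.obj X :=
  P.tuple (fun k => Nat.casesOn k 0 (fun k => P.π X k))

@[simp]
theorem shift_π_zero (X : C) : P.shift X ≫ P.π X 0 = 0 := P.tuple_π _ 0

@[simp]
theorem shift_π_succ (X : C) (k : ℕ) : P.shift X ≫ P.π X (k + 1) = P.π X k := P.tuple_π _ (k + 1)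

theorem isLinear_shift (X : C) : D.IsLinear (P.shift X) :=
  P.isLinear_tuple fun k => by
    cases k with
    | zero => exact D.isLinear_zero _ _
    | succ k => exact P.isLinear_π X k

/-- The Leibniz rule for the product with the indeterminate. -/
theorem shift_shiftDeriv (X : C) :
    P.shift X ≫ P.shiftDeriv X = P.shiftDeriv X ≫ P.shift X + 𝟙 (P.obj X) := by
  refine P.hom_ext fun k => ?_
  rw [(P.isLinear_π X k).add_comp, Category.assoc, Category.assoc, shiftDeriv_π, Category.id_comp,
    LeftAdditiveCategory.comp_smul, shift_π_succ]
  cases k with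
  | zero => simp
  | succ k =>
    rw [shift_π_succ, shiftDeriv_π, Nat.cast_succ (k + 1), add_smul, one_smul]

/-- The derivative of a Taylor expansion is linear over the power series, in the variation. -/
theorem lift_shift_d_T (hR : HasIntegerInverses R) (f : X ⟶ Y) (x a : Z ⟶ P.obj X) :
    lift x (a ≫ P.shift X) ≫ D.d (P.T f) = lift x a ≫ D.d (P.T f) ≫ P.shift Y := by
  suffices H : lift (fst _ _) (snd _ _ ≫ P.shift X) ≫ D.d (P.T f) = D.d (P.T f) ≫ P.shift Y by
    rw [← H, comp_lift_assoc, lift_fst, lift_snd_assoc]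
  have hσ := P.isLinear_shiftDeriv X
  have hd : D.d (P.T f) ≫ P.shiftDeriv Y = D.lie
      (lift (fst _ _ ≫ P.shiftDeriv X) (snd _ _ ≫ P.shiftDeriv X)) (D.d (P.T f)) := by
    rw [← D.d_lie hσ, P.lie_T hR, (P.isLinear_shiftDeriv Y).d_comp]
  -- both sides solve `dh/dε = L h + d (T f)`, where `L` is the derivative along `(σ, σ)` for the
  -- derivative `σ` of power series, and have the value `0` at `ε = 0`
  refine P.eq_of_lie_add hR (lift (fst _ _ ≫ P.shiftDeriv X) (snd _ _ ≫ P.shiftDeriv X))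
    (D.d (P.T f)) ?_ ?_ ?_
  · have h : D.d (P.T f) ≫ P.π Y 0 =
        lift (fst _ _ ≫ P.π X 0) (snd _ _ ≫ P.π X 0) ≫ D.d f := by
      rw [← (P.isLinear_π Y 0).d_comp, T_π_zero, D.d_comp, (P.isLinear_π X 0).d_eq]
    rw [Category.assoc, h, comp_lift_assoc, lift_fst_assoc, lift_snd_assoc, Category.assoc,
      shift_π_zero, comp_zero, D.d_arg_zero, Category.assoc, shift_π_zero, comp_zero]
  · have hl : D.IsLinear (lift (fst (P.obj X) (P.obj X)) (snd _ _ ≫ P.shift X)) :=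
      (D.isLinear_fst _ _).lift ((D.isLinear_snd _ _).comp (P.isLinear_shift X))
    have e : ∀ (p q : P.obj X ⊗ P.obj X ⟶ P.obj X), lift p (q + snd _ _) =
        lift p q + lift 0 (snd _ _) := fun p q => by rw [← D.lift_add, add_zero]
    rw [Category.assoc, hd, D.lie_comp, D.comp_lie, hl.lie_eq]
    simp only [comp_lift, lift_fst_assoc, lift_snd_assoc, lift_fst, Category.assoc,
      shift_shiftDeriv, comp_add, Category.comp_id]
    rw [e, D.d_arg_add, D.d_d_zero, lift_fst_snd, Category.id_comp]
  · rw [Category.assoc, shift_shiftDeriv, comp_add, Category.comp_id, ← Category.assoc, hd,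
      (P.isLinear_shift Y).lie_comp]

/-- The derivative of a twofold Taylor expansion is linear over the inner power series. -/
theorem lift_map_shift_d_T_T (hR : HasIntegerInverses R) (f : X ⟶ Y)
    (x a : Z ⟶ P.obj (P.obj X)) :
    lift x (a ≫ P.map (P.shift X)) ≫ D.d (P.T (P.T f)) =
      lift x a ≫ D.d (P.T (P.T f)) ≫ P.map (P.shift Y) := by
  have hs := D.isLinear_snd (P.obj X) (P.obj X)
  have h := congrArg P.T (P.lift_shift_d_T hR f (fst _ _) (snd _ _))
  rw [P.T_lift_d hR, lift_fst_snd, Category.id_comp, P.T_comp_linear hR _ (P.isLinear_shift Y),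
    P.T_eq_map hR (D.isLinear_fst _ _), P.T_comp_linear hR _ (P.isLinear_shift X),
    P.T_eq_map hR hs, P.T_d hR] at h
  -- `z` pairs the two sequences `x` and `a` coordinatewise
  let z : Z ⟶ P.obj (P.obj X ⊗ P.obj X) := P.tuple (fun k => lift (x ≫ P.π _ k) (a ≫ P.π _ k))
  have hz1 : z ≫ P.map (fst _ _) = x := P.hom_ext fun k => by simp [z]
  have hz2 : z ≫ P.map (snd _ _) = a := P.hom_ext fun k => by simp [z]
  have h' := congrArg (fun g => z ≫ g) h
  simpa only [comp_lift_assoc, reassoc_of% hz2, hz1, hz2, Category.assoc] using h'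

/-! ### Naturality -/

theorem isLinear_inj (X : C) : D.IsLinear (P.inj X) :=
  P.isLinear_tuple fun k => by
    split_ifs
    exacts [D.isLinear_id X, D.isLinear_zero X X]

@[simp]
theorem inj_π_zero (X : C) : P.inj X ≫ P.π X 0 = 𝟙 X := P.tuple_π _ 0

@[simp]
theorem inj_π_succ (X : C) (k : ℕ) : P.inj X ≫ P.π X (k + 1) = 0 := P.tuple_π _ (k + 1)

theorem inj_shiftDeriv (X : C) : P.inj X ≫ P.shiftDeriv X = 0 := by
  refine P.hom_ext fun k => ?_
  rw [Category.assoc, shiftDeriv_π, LeftAdditiveCategory.comp_smul, inj_π_succ, smul_zero,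
    (P.isLinear_π X k).zero_comp]

theorem inj_natural (hR : HasIntegerInverses R) (f : X ⟶ Y) :
    f ≫ P.inj Y = P.inj X ≫ P.T f := by
  refine P.eq_of_lie hR 0 ?_ ?_ ?_
  · rw [Category.assoc, inj_π_zero, Category.assoc, T_π_zero, reassoc_of% (P.inj_π_zero X),
      Category.comp_id]
  · rw [D.lie_zero, Category.assoc, inj_shiftDeriv, comp_zero]
  · exact P.lie_comp_T hR (P.isLinear_inj X)
      (by rw [inj_shiftDeriv, (P.isLinear_inj X).zero_comp]) f

theorem isLinear_scale (r : R) (X : C) : D.IsLinear (P.scale r X) :=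
  P.isLinear_tuple fun k => (P.isLinear_π X k).smul _

@[simp]
theorem scale_π (r : R) (X : C) (k : ℕ) : P.scale r X ≫ P.π X k = r ^ k • P.π X k :=
  P.tuple_π _ k

theorem scale_shiftDeriv (r : R) (X : C) :
    P.scale r X ≫ P.shiftDeriv X = (r • P.shiftDeriv X) ≫ P.scale r X := by
  refine P.hom_ext fun k => ?_
  rw [(P.isLinear_scale r X).smul_comp, (P.isLinear_π X k).smul_comp, Category.assoc,
    Category.assoc, shiftDeriv_π, scale_π, LeftAdditiveCategory.comp_smul,
    LeftAdditiveCategory.comp_smul, scale_π, shiftDeriv_π, smul_smul, smul_smul, smul_smul]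
  congr 1
  ring

theorem scale_natural (hR : HasIntegerInverses R) (r : R) (f : X ⟶ Y) :
    P.T f ≫ P.scale r Y = P.scale r X ≫ P.T f := by
  refine P.eq_of_lie hR (r • P.shiftDeriv X) ?_ ?_
    (P.lie_comp_T hR (P.isLinear_scale r X) (P.scale_shiftDeriv r X) f)
  · rw [Category.assoc, Category.assoc, scale_π, T_π_zero, ← Category.assoc, scale_π, pow_zero,
      one_smul, one_smul, T_π_zero]
  · rw [(P.isLinear_scale r Y).lie_comp, D.smul_lie, P.lie_T hR, Category.assoc, scale_shiftDeriv,
      (P.isLinear_scale r Y).smul_comp, (P.isLinear_scale r Y).smul_comp,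
      LeftAdditiveCategory.comp_smul, Category.assoc]

theorem isLinear_mult (X : C) : D.IsLinear (P.mult X) :=
  P.isLinear_tuple fun _ => D.isLinear_sum _ fun _ => (P.isLinear_π _ _).comp (P.isLinear_π _ _)

theorem mult_π (X : C) (k : ℕ) : P.mult X ≫ P.π X k =
    ∑ p ∈ Finset.HasAntidiagonal.antidiagonal k, P.π (P.obj X) p.2 ≫ P.π X p.1 :=
  P.tuple_π _ k

theorem mult_π_zero (X : C) : P.mult X ≫ P.π X 0 = P.π (P.obj X) 0 ≫ P.π X 0 := by
  rw [mult_π, Finset.HasAntidiagonal.antidiagonal_zero, Finset.sum_singleton]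

/-- The chain rule for the diagonal: the derivative of a product of power series. -/
theorem mult_shiftDeriv (X : C) : P.mult X ≫ P.shiftDeriv X =
    (P.shiftDeriv (P.obj X) + P.map (P.shiftDeriv X)) ≫ P.mult X := by
  refine P.hom_ext fun k => ?_
  rw [(P.isLinear_mult X).add_comp, (P.isLinear_π X k).add_comp]
  simp only [Category.assoc, shiftDeriv_π, LeftAdditiveCategory.comp_smul, mult_π, comp_finset_sum]
  simp only [← Category.assoc, shiftDeriv_π, (P.isLinear_π X _).smul_comp, map_π]
  simp only [Category.assoc, shiftDeriv_π, LeftAdditiveCategory.comp_smul]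
  have h : ((k + 1 : ℕ) : R) • ∑ p ∈ Finset.HasAntidiagonal.antidiagonal (k + 1),
        P.π (P.obj X) p.2 ≫ P.π X p.1 =
      ∑ p ∈ Finset.HasAntidiagonal.antidiagonal (k + 1),
        ((p.2 : R) • P.π (P.obj X) p.2 ≫ P.π X p.1 +
          (p.1 : R) • P.π (P.obj X) p.2 ≫ P.π X p.1) := by
    rw [Finset.smul_sum]
    refine Finset.sum_congr rfl fun p hp => ?_
    rw [← add_smul, ← Nat.cast_add, add_comm p.2, Finset.HasAntidiagonal.mem_antidiagonal.mp hp]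
  rw [h, Finset.sum_add_distrib]
  congr 1
  · rw [Finset.Nat.sum_antidiagonal_succ', Nat.cast_zero, zero_smul, zero_add]
  · rw [Finset.Nat.sum_antidiagonal_succ, Nat.cast_zero, zero_smul, zero_add]

theorem mult_natural (hR : HasIntegerInverses R) (f : X ⟶ Y) :
    P.T (P.T f) ≫ P.mult Y = P.mult X ≫ P.T f := by
  refine P.eq_of_lie hR (P.shiftDeriv (P.obj X) + P.map (P.shiftDeriv X)) ?_ ?_
    (P.lie_comp_T hR (P.isLinear_mult X) (P.mult_shiftDeriv X) f)
  · simp only [Category.assoc, mult_π_zero, T_π_zero, T_π_zero_assoc]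
    rw [← Category.assoc (P.mult X), mult_π_zero, Category.assoc]
  · rw [(P.isLinear_mult Y).lie_comp, D.lie_add, P.lie_T hR, P.lie_map_T_T hR, Category.assoc,
      mult_shiftDeriv, ← comp_add, Category.assoc]

theorem swap_π (X : C) (j : ℕ) : P.swap X ≫ P.π (P.obj X) j = P.map (P.π X j) := P.tuple_π _ j

theorem isLinear_swap (X : C) : D.IsLinear (P.swap X) :=
  P.isLinear_tuple fun _ => P.isLinear_tuple fun _ => (P.isLinear_π _ _).comp (P.isLinear_π _ _)

theorem swap_shiftDeriv (X : C) : P.swap X ≫ P.shiftDeriv (P.obj X) =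
    P.map (P.shiftDeriv X) ≫ P.swap X := by
  refine P.hom_ext fun j => P.hom_ext fun i => ?_
  simp only [Category.assoc, (P.isLinear_π _ _).smul_comp, shiftDeriv_π, swap_π, map_π,
    LeftAdditiveCategory.comp_smul, map_π_assoc]

theorem swap_natural (hR : HasIntegerInverses R) (f : X ⟶ Y) :
    P.T (P.T f) ≫ P.swap Y = P.swap X ≫ P.T (P.T f) := by
  refine P.eq_of_lie hR (P.map (P.shiftDeriv X)) ?_ ?_
    (P.lie_comp_T hR (P.isLinear_swap X) (P.swap_shiftDeriv X) _)
  · rw [Category.assoc, swap_π, Category.assoc, T_π_zero, ← Category.assoc (P.swap X), swap_π,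
      ← P.T_comp_linear hR _ (P.isLinear_π Y 0), T_π_zero, P.T_linear_comp hR (P.isLinear_π X 0)]
  · rw [(P.isLinear_swap Y).lie_comp, P.lie_map_T_T hR, Category.assoc, Category.assoc,
      swap_shiftDeriv]

theorem diag_π_π (X : C) (i j : ℕ) :
    P.diag X ≫ P.π (P.obj X) j ≫ P.π X i = if i = j then P.π X i else 0 := by
  rw [diag, tuple_π_assoc, tuple_π]

theorem isLinear_diag (X : C) : D.IsLinear (P.diag X) :=
  P.isLinear_tuple fun _ => P.isLinear_tuple fun _ => by
    split_ifs
    exacts [P.isLinear_π _ _, D.isLinear_zero _ _]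

theorem diag_π_zero (X : C) : P.diag X ≫ P.π (P.obj X) 0 = P.π X 0 ≫ P.inj X := by
  refine P.hom_ext fun i => ?_
  rw [Category.assoc, diag_π_π]
  cases i with
  | zero => simp
  | succ i => simp

/-- The derivative of `x (ε₁ ε₂)` in `ε₂` is `ε₁ x' (ε₁ ε₂)`. -/
theorem diag_shiftDeriv (X : C) : P.diag X ≫ P.shiftDeriv (P.obj X) =
    P.shiftDeriv X ≫ P.diag X ≫ P.map (P.shift X) := by
  refine P.hom_ext fun j => P.hom_ext fun i => ?_
  simp only [Category.assoc, shiftDeriv_π, map_π, (P.isLinear_π _ _).smul_comp,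
    LeftAdditiveCategory.comp_smul, diag_π_π]
  cases i with
  | zero => simp
  | succ i =>
    rw [shift_π_succ, diag_π_π]
    by_cases h : i = j
    · subst h
      simp [shiftDeriv_π]
    · simp [h]

theorem diag_natural (hR : HasIntegerInverses R) (f : X ⟶ Y) :
    P.T f ≫ P.diag Y = P.diag X ≫ P.T (P.T f) := by
  -- both sides satisfy `dh/dε₂ = ε₁ L_σ h`, where `σ` is the derivative of power series
  have h1 : (P.T f ≫ P.diag Y) ≫ P.shiftDeriv (P.obj Y) =
      D.lie (P.shiftDeriv X) (P.T f ≫ P.diag Y) ≫ P.map (P.shift Y) := by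
    rw [(P.isLinear_diag Y).lie_comp, P.lie_T hR]
    simp only [Category.assoc, diag_shiftDeriv]
  have h2 : (P.diag X ≫ P.T (P.T f)) ≫ P.shiftDeriv (P.obj Y) =
      D.lie (P.shiftDeriv X) (P.diag X ≫ P.T (P.T f)) ≫ P.map (P.shift Y) := by
    rw [Category.assoc, ← P.lie_T hR, D.comp_lie, diag_shiftDeriv, ← Category.assoc,
      P.lift_map_shift_d_T_T hR, D.lie_comp, (P.isLinear_diag X).lie_eq, Category.assoc]
  refine P.eq_of_shiftDeriv hR ?_ fun n hn => ?_
  · rw [Category.assoc, diag_π_zero, T_π_zero_assoc, Category.assoc, T_π_zero,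
      ← Category.assoc (P.diag X), diag_π_zero, Category.assoc, P.inj_natural hR]
  · have hπ := P.isLinear_π (P.obj Y) n
    rw [← Category.assoc, h1, ← Category.assoc (P.diag X ≫ _), h2, Category.assoc, Category.assoc,
      map_π, ← Category.assoc, ← hπ.lie_comp, hn, hπ.lie_comp, Category.assoc]

/-! ### The sum of all coordinates -/

theorem isLinear_sum (X : C) : D.IsLinear (P.sum X) := D.isLinear_csum fun _ => P.isLinear_π X _

theorem comp_sum (f : Z ⟶ P.obj X) : f ≫ P.sum X = csum (fun k : ℕ => f ≫ P.π X k) :=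
  LeftSumCategory.comp_csum _ _

theorem map_sum {h : X ⟶ Y} (hh : D.IsLinear h) : P.map h ≫ P.sum Y = P.sum X ≫ h := by
  rw [comp_sum, sum, hh.csum_comp]
  simp only [map_π]

theorem mult_sum (X : C) : P.mult X ≫ P.sum X = P.sum (P.obj X) ≫ P.sum X := by
  have h := csum_antidiagonal (fun i j => P.π (P.obj X) i ≫ P.π X j)
  have hS : P.sum (P.obj X) = csum (fun k : ℕ => P.π (P.obj X) k) := rfl
  rw [comp_sum, hS, (P.isLinear_sum X).csum_comp]
  simp only [mult_π, comp_sum]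
  exact h

theorem shift_sum (X : C) : P.shift X ≫ P.sum X = P.sum X := by
  rw [comp_sum, csum_nat_succ, shift_π_zero, zero_add]
  simp only [shift_π_succ]
  rfl

theorem inj_sum (X : C) : P.inj X ≫ P.sum X = 𝟙 X := by
  rw [comp_sum, csum_nat_succ, inj_π_zero]
  simp only [inj_π_succ]
  rw [csum_zero, add_zero]

/-! ### The infinitesimal form of analyticity -/

/-- The monomial of degree `k`: the sequence with `x` at the index `k`, and `0` elsewhere. -/
def monomial (X : C) : ℕ → (X ⟶ P.obj X)
  | 0 => P.inj X
  | k + 1 => monomial X k ≫ P.shift X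

theorem monomial_π (X : C) (k n : ℕ) :
    P.monomial X k ≫ P.π X n = if k = n then 𝟙 X else 0 := by
  induction k generalizing n with
  | zero => cases n <;> simp [monomial]
  | succ k ih => cases n <;> simp [monomial, ih]

theorem csum_monomial (X : C) : csum (fun k => P.π X k ≫ P.monomial X k) = 𝟙 (P.obj X) := by
  refine P.hom_ext fun n => ?_
  rw [(P.isLinear_π X n).csum_comp, Category.id_comp]
  refine Eq.trans (congrArg csum (funext fun k => ?_)) (csum_ite_eq n fun k => P.π X k)
  rw [Category.assoc, monomial_π]
  split_ifs <;> simp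

/-- The sum of the coordinates of a derivative of `T f` depends on the variation only through the
sum of its coordinates. This holds without any convergence hypothesis. -/
theorem lift_d_T_sum (hR : HasIntegerInverses R) (f : X ⟶ Y) (x a : Z ⟶ P.obj X) :
    lift x a ≫ D.d (P.T f) ≫ P.sum Y =
      lift x (a ≫ P.sum X ≫ P.inj X) ≫ D.d (P.T f) ≫ P.sum Y := by
  have hs := P.isLinear_sum Y
  have key : ∀ (k : ℕ) (b : Z ⟶ X), lift x (b ≫ P.monomial X k) ≫ D.d (P.T f) ≫ P.sum Y =
      lift x (b ≫ P.inj X) ≫ D.d (P.T f) ≫ P.sum Y := by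
    intro k b
    induction k with
    | zero => rfl
    | succ k ih =>
      rw [← ih, monomial, ← Category.assoc, ← Category.assoc, P.lift_shift_d_T hR, Category.assoc,
        Category.assoc, shift_sum]
  have hsum : ∀ (b : ℕ → (Z ⟶ P.obj X)), lift x (csum b) ≫ D.d (P.T f) ≫ P.sum Y =
      csum (fun k => lift x (b k) ≫ D.d (P.T f) ≫ P.sum Y) := by
    intro b
    rw [← Category.assoc, D.d_arg_csum, hs.csum_comp]
    simp only [Category.assoc]
  have ha : a = csum (fun k => (a ≫ P.π X k) ≫ P.monomial X k) := by
    simp only [Category.assoc]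
    rw [← LeftSumCategory.comp_csum, csum_monomial, Category.comp_id]
  have ha' : a ≫ P.sum X ≫ P.inj X = csum (fun k => (a ≫ P.π X k) ≫ P.inj X) := by
    rw [← Category.assoc, comp_sum, (P.isLinear_inj X).csum_comp]
  conv_lhs => rw [ha]
  rw [ha', hsum, hsum]
  simp only [key]

/-- On a sequence of power series (the outer index numbers the sequence), replace the constant
coefficients by `0`, except for that of the power series with index `0`. -/
def dropConst (X : C) : P.obj (P.obj X) ⟶ P.obj (P.obj X) :=
  P.tuple (fun k => P.tuple (fun i => if i = 0 ∧ k ≠ 0 then 0 else P.π (P.obj X) k ≫ P.π X i))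

theorem dropConst_π_π (X : C) (k i : ℕ) : P.dropConst X ≫ P.π (P.obj X) k ≫ P.π X i =
    if i = 0 ∧ k ≠ 0 then 0 else P.π (P.obj X) k ≫ P.π X i := by
  rw [dropConst, tuple_π_assoc, tuple_π]

theorem isLinear_dropConst (X : C) : D.IsLinear (P.dropConst X) :=
  P.isLinear_tuple fun _ => P.isLinear_tuple fun _ => by
    split_ifs
    exacts [D.isLinear_zero _ _, (P.isLinear_π _ _).comp (P.isLinear_π _ _)]

theorem dropConst_map_π_zero (X : C) : P.dropConst X ≫ P.map (P.π X 0) =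
    P.π (P.obj X) 0 ≫ P.π X 0 ≫ P.inj X := by
  refine P.hom_ext fun k => ?_
  rw [Category.assoc, map_π, dropConst_π_π]
  cases k <;> simp

theorem inj_dropConst (X : C) : P.inj (P.obj X) ≫ P.dropConst X = P.inj (P.obj X) := by
  refine P.hom_ext fun k => P.hom_ext fun i => ?_
  rw [Category.assoc, Category.assoc, dropConst_π_π]
  cases k with
  | zero => rw [if_neg (by simp), Category.assoc]
  | succ k =>
    rw [inj_π_succ, (P.isLinear_π X i).zero_comp]
    split_ifs
    · simp
    · rw [← Category.assoc, inj_π_succ, (P.isLinear_π X i).zero_comp]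

theorem T_smul (hR : HasIntegerInverses R) (r : R) (f : X ⟶ Y) : P.T (r • f) = r • P.T f := by
  have h := P.T_comp_linear hR f ((D.isLinear_id Y).smul r)
  rw [LeftAdditiveCategory.comp_smul, Category.comp_id] at h
  rw [h]
  refine P.hom_ext fun k => ?_
  rw [(P.isLinear_π Y k).smul_comp, Category.assoc, map_π, LeftAdditiveCategory.comp_smul,
    Category.comp_id, LeftAdditiveCategory.comp_smul]

/-- Each Taylor coefficient is polynomial in the coordinates of positive index, hence it commutes
with the sums of sequences whose coordinate of index `0` is constant. -/
theorem dropConst_T_T_π_sum (hR : HasIntegerInverses R) (f : X ⟶ Y) (n : ℕ) :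
    P.dropConst X ≫ P.T (P.T f ≫ P.π Y n) ≫ P.sum Y =
      P.dropConst X ≫ P.sum (P.obj X) ≫ P.T f ≫ P.π Y n := by
  induction n with
  | zero =>
    have h0 := P.isLinear_π X 0
    rw [T_π_zero, P.T_linear_comp hR h0, ← Category.assoc (P.sum _), ← P.map_sum h0,
      Category.assoc, ← Category.assoc, dropConst_map_π_zero]
    simp only [Category.assoc]
    rw [← Category.assoc (P.dropConst X), dropConst_map_π_zero]
    simp only [Category.assoc]
    rw [← Category.assoc (P.inj X), ← P.inj_natural hR, Category.assoc, inj_sum,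
      reassoc_of% (P.inj_sum X), Category.comp_id]
  | succ n ih =>
    have hσ := P.isLinear_shiftDeriv X
    have hs := P.isLinear_sum Y
    have hρ := P.isLinear_dropConst X
    have hS := P.isLinear_sum (P.obj X)
    refine smul_cancel_nat hR n.succ_pos ?_
    have h1 : ((n + 1 : ℕ) : R) • (P.dropConst X ≫ P.T (P.T f ≫ P.π Y (n + 1)) ≫ P.sum Y) =
        P.dropConst X ≫ D.lie (P.map (P.shiftDeriv X)) (P.T (P.T f ≫ P.π Y n)) ≫ P.sum Y := by
      rw [← P.T_lie hR hσ, P.lie_T_π hR, P.T_smul hR, hs.smul_comp, LeftAdditiveCategory.comp_smul]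
    have h2 : ((n + 1 : ℕ) : R) • (P.dropConst X ≫ P.sum (P.obj X) ≫ P.T f ≫ P.π Y (n + 1)) =
        P.dropConst X ≫ P.sum (P.obj X) ≫ D.lie (P.shiftDeriv X) (P.T f ≫ P.π Y n) := by
      rw [P.lie_T_π hR, LeftAdditiveCategory.comp_smul, LeftAdditiveCategory.comp_smul]
    refine h1.trans (Eq.trans ?_ h2.symm)
    generalize P.T f ≫ P.π Y n = g at ih
    -- `χ` is the variation of the base point, with the sum of its coordinates moved to the
    -- coordinate of index `0`
    let χ := P.dropConst X ≫ P.map (P.shiftDeriv X) ≫ P.sum (P.obj X) ≫ P.inj (P.obj X)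
    have hχ : χ ≫ P.dropConst X = χ := by simp only [χ, Category.assoc, inj_dropConst]
    have hχ' : χ ≫ P.sum (P.obj X) = P.dropConst X ≫ P.sum (P.obj X) ≫ P.shiftDeriv X := by
      simp only [χ, Category.assoc, inj_sum, Category.comp_id, P.map_sum hσ]
    calc P.dropConst X ≫ D.lie (P.map (P.shiftDeriv X)) (P.T g) ≫ P.sum Y
        = lift (P.dropConst X) χ ≫ D.d (P.T g) ≫ P.sum Y := by
          rw [← Category.assoc, D.comp_lie, Category.assoc, P.lift_d_T_sum hR]
          simp only [χ, Category.assoc]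
      _ = D.lie χ (P.dropConst X ≫ P.T g ≫ P.sum Y) := by
          rw [D.lie_comp, hρ.lie_eq, hχ, hs.d_comp]
      _ = D.lie χ ((P.dropConst X ≫ P.sum (P.obj X)) ≫ g) := by rw [ih, Category.assoc]
      _ = P.dropConst X ≫ P.sum (P.obj X) ≫ D.lie (P.shiftDeriv X) g := by
          rw [D.lie_comp, (hρ.comp hS).lie_eq, ← Category.assoc χ, hχ, hχ', ← Category.assoc,
            D.comp_lie, comp_lift_assoc, Category.assoc]

theorem dropConst_T_T_sum (hR : HasIntegerInverses R) (f : X ⟶ Y) :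
    P.dropConst X ≫ P.T (P.T f) ≫ P.sum (P.obj Y) =
      P.dropConst X ≫ P.sum (P.obj X) ≫ P.T f := by
  refine P.hom_ext fun n => ?_
  have hn := P.isLinear_π Y n
  have h := P.dropConst_T_T_π_sum hR f n
  rw [P.T_comp_linear hR _ hn, Category.assoc, P.map_sum hn] at h
  simpa only [Category.assoc] using h

/-! ### Affine sequences -/

/-- The affine power series `x + ε a`. -/
def affine (X : C) : X ⊗ X ⟶ P.obj X :=
  P.tuple (fun k => if k = 0 then fst X X else if k = 1 then snd X X else 0)

theorem affine_π (X : C) (k : ℕ) : P.affine X ≫ P.π X k =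
    if k = 0 then fst X X else if k = 1 then snd X X else 0 := P.tuple_π _ k

theorem isLinear_affine (X : C) : D.IsLinear (P.affine X) :=
  P.isLinear_tuple fun _ => by
    split_ifs
    exacts [D.isLinear_fst _ _, D.isLinear_snd _ _, D.isLinear_zero _ _]

/-- Splits a power series `x` as an affine power series in a new indeterminate `η`, whose
coefficients are power series: `x = x₀ + ε x₁ + ε² x₂ + ⋯` is the value at `η = ε` of
`x₀ + η (x₁ + ε x₂ + ⋯)`. The outer index is the power of `ε`. -/
def split (X : C) : P.obj X ⟶ P.obj (P.obj X) :=
  P.tuple (fun k => P.tuple (fun i =>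
    if i = 0 then (if k = 0 then P.π X 0 else 0) else if i = 1 then P.π X (k + 1) else 0))

theorem split_π_π (X : C) (k i : ℕ) : P.split X ≫ P.π (P.obj X) k ≫ P.π X i =
    if i = 0 then (if k = 0 then P.π X 0 else 0) else if i = 1 then P.π X (k + 1) else 0 := by
  rw [split, tuple_π_assoc, tuple_π]

theorem split_dropConst (X : C) : P.split X ≫ P.dropConst X = P.split X := by
  refine P.hom_ext fun k => P.hom_ext fun i => ?_
  rw [Category.assoc, Category.assoc, dropConst_π_π, Category.assoc, split_π_π]
  split_ifs <;> simp_all [split_π_π]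

theorem split_mult (X : C) : P.split X ≫ P.mult X = 𝟙 (P.obj X) := by
  refine P.hom_ext fun k => ?_
  rw [Category.assoc, mult_π, comp_finset_sum, Category.id_comp]
  simp only [split_π_π]
  cases k with
  | zero => simp
  | succ k =>
    rw [Finset.sum_eq_single (1, k)]
    · simp
    · rintro ⟨i, j⟩ hp hne
      rw [Finset.HasAntidiagonal.mem_antidiagonal] at hp
      have h1 : i = 0 → j ≠ 0 := by rintro rfl; simp only at hp; omega
      have h2 : i ≠ 1 := by
        rintro rfl
        exact hne (by simp only at hp; ext <;> simp; omega)
      grind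
    · intro h
      exact absurd (by simp; omega) h

theorem split_sum (X : C) : P.split X ≫ P.sum (P.obj X) =
    lift (P.π X 0) (csum (fun k : ℕ => P.π X (k + 1))) ≫ P.affine X := by
  refine P.hom_ext fun i => ?_
  rw [comp_sum, (P.isLinear_π X i).csum_comp, Category.assoc, affine_π]
  simp only [Category.assoc, split_π_π]
  split_ifs with h0 h1
  · rw [csum_ite_eq 0 (fun _ => P.π X 0), lift_fst]
  · rw [lift_snd]
  · rw [csum_zero, comp_zero]

/-! ### Taylor formula and analyticity -/

/-- The Taylor formula on affine power series suffices for the naturality of the sum. -/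
theorem sum_natural_of_affine (hR : HasIntegerInverses R) (f : X ⟶ Y)
    (h : P.affine X ≫ P.T f ≫ P.sum Y = (fst X X + snd X X) ≫ f) :
    P.T f ≫ P.sum Y = P.sum X ≫ f := by
  calc P.T f ≫ P.sum Y
      = P.split X ≫ P.mult X ≫ P.T f ≫ P.sum Y := by
        rw [← Category.assoc, split_mult, Category.id_comp]
    _ = P.split X ≫ P.dropConst X ≫ P.T (P.T f) ≫ P.sum (P.obj Y) ≫ P.sum Y := by
        rw [← mult_sum, reassoc_of% (P.mult_natural hR f), reassoc_of% (P.split_dropConst X)]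
    _ = P.split X ≫ P.sum (P.obj X) ≫ P.T f ≫ P.sum Y := by
        have := P.dropConst_T_T_sum hR f
        rw [reassoc_of% this, reassoc_of% (P.split_dropConst X)]
    _ = P.sum X ≫ f := by
        rw [reassoc_of% (P.split_sum X), h, ← Category.assoc, comp_add, lift_fst, lift_snd,
          ← csum_nat_succ (fun k => P.π X k), sum]

/-- Iterating the derivative in the base point, in a constant direction. -/
theorem iterate_lie_fst (D : Derivative R C) (f : X ⟶ Y) (n : ℕ) :
    (D.lie (lift (snd X X) 0))^[n] (fst X X ≫ f) =
      tup n (fun i => if i = 0 then fst X X else snd X X) ≫ D.hod f n := by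
  induction n with
  | zero => rfl
  | succ n ih =>
    have hlin : D.IsLinear (tup n (fun i => if i = 0 then fst X X else snd X X)) :=
      isLinear_tup n fun i => by
        split_ifs
        exacts [D.isLinear_fst _ _, D.isLinear_snd _ _]
    have htup : tup (n + 1) (fun i => if i = 0 then fst X X else snd X X) =
        lift (tup n (fun i => if i = 0 then fst X X else snd X X)) (snd X X) := by
      simp [tup, Fin.castSucc_eq_zero_iff]
    rw [Function.iterate_succ_apply', ih, D.lie_comp, hlin.lie_eq, htup, Derivative.hod,
      comp_lift_assoc, lift_fst, comp_tup, comp_tup]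
    congr 3
    funext i
    split_ifs <;> simp

theorem affine_T_π (hR : HasIntegerInverses R) (f : X ⟶ Y) (n : ℕ) :
    P.affine X ≫ P.T f ≫ P.π Y n = invNat R n.factorial •
      (tup n (fun i => if i = 0 then fst X X else snd X X) ≫ D.hod f n) := by
  refine eq_invNat_smul hR n.factorial_pos ?_
  rw [← iterate_lie_fst]
  have hσ : P.affine X ≫ P.shiftDeriv X = lift (snd X X) 0 ≫ P.affine X := by
    refine P.hom_ext fun k => ?_
    rw [Category.assoc, Category.assoc, shiftDeriv_π, LeftAdditiveCategory.comp_smul, affine_π,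
      affine_π]
    match k with
    | 0 => simp
    | 1 => simp
    | k + 2 => simp
  induction n with
  | zero => simp [affine_π, ← Category.assoc]
  | succ n ih =>
    rw [Function.iterate_succ_apply', ← ih, D.lie_smul, D.lie_comp_of_related
      (by rw [(P.isLinear_affine X).lie_eq, hσ]), P.lie_T_π hR, LeftAdditiveCategory.comp_smul,
      smul_smul, Nat.factorial_succ, Nat.cast_mul, mul_comm]

/-- The right-hand side of the Taylor formula is the sum of the Taylor expansion at `x + ε a`. -/
theorem lift_affine_T_sum (hR : HasIntegerInverses R) (f : X ⟶ Y) (x a : Z ⟶ X) :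
    lift x a ≫ P.affine X ≫ P.T f ≫ P.sum Y = csum (fun k : ℕ => invNat R k.factorial •
      (tup k (fun i => if i = 0 then x else a) ≫ D.hod f k)) := by
  rw [← Category.assoc (P.affine X), comp_sum, LeftSumCategory.comp_csum]
  congr 1
  funext k
  rw [Category.assoc, P.affine_T_π hR, LeftAdditiveCategory.comp_smul, ← Category.assoc, comp_tup]
  congr 4
  funext i
  split_ifs <;> simp

theorem isTaylor_iff (hR : HasIntegerInverses R) : D.IsTaylor ↔
    ∀ {X Y : C} (f : X ⟶ Y), P.affine X ≫ P.T f ≫ P.sum Y = (fst X X + snd X X) ≫ f := by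
  constructor
  · intro h X Y f
    have := P.lift_affine_T_sum hR f (fst X X) (snd X X)
    rw [csum_factorial_smul hR, lift_fst_snd, Category.id_comp] at this
    rw [this, h.2]
    rfl
  · intro h
    refine ⟨hR, fun {X Y Z} f x a => ?_⟩
    have := P.lift_affine_T_sum hR f x a
    rw [csum_factorial_smul hR, h, ← Category.assoc, comp_add, lift_fst, lift_snd] at this
    exact this

theorem isTaylor_iff_isAnalytic (hR : HasIntegerInverses R) :
    D.IsTaylor ↔ P.IsAnalytic P.T := by
  rw [P.isTaylor_iff hR]
  refine ⟨fun h => ⟨fun f => P.sum_natural_of_affine hR f (h f)⟩, fun h X Y f => ?_⟩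
  rw [h.sum_natural, ← Category.assoc, comp_sum, csum_nat_succ, csum_nat_succ]
  simp only [affine_π]
  simp [csum_zero]

theorem isTaylorExpansion_T (hR : HasIntegerInverses R) : P.IsTaylorExpansion P.T where
  map_id := P.T_id hR
  map_comp := P.T_comp hR
  map_fst X Y := P.T_eq_map hR (D.isLinear_fst X Y)
  map_snd X Y := P.T_eq_map hR (D.isLinear_snd X Y)
  map_proj X k := P.T_eq_map hR (P.isLinear_π X k)
  map_add X := P.T_eq_map hR ((D.isLinear_fst X X).add (D.isLinear_snd X X))
  map_sum X := P.T_eq_map hR (P.isLinear_sum X)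
  map_smul r X := P.T_eq_map hR ((D.isLinear_id X).smul r)
  proj_natural f := P.T_π_zero f
  inj_natural f := P.inj_natural hR f
  mult_natural f := P.mult_natural hR f
  scale_natural r _ _ f := P.scale_natural hR r f
  swap_natural f := P.swap_natural hR f
  diag_natural f := P.diag_natural hR f

/-! ### Models of the differential lambda-calculus -/

/-- The application of `λ a'. f (x + a')` to `a` is the Taylor series of `f` at `x`. -/
theorem isTaylor_of_modelsTaylorExpansion (hR : HasIntegerInverses R) [MonoidalClosed C]
    (h : D.ModelsTaylorExpansion) : D.IsTaylor := by
  refine ⟨hR, fun {X Y Z} f x a => ?_⟩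
  let ψ : X ⊗ Z ⟶ X ⊗ X := lift (fst X Z + snd X Z ≫ x) (snd X Z ≫ a)
  have hψ : D.lie (lift (snd X Z ≫ a) 0) ψ = ψ ≫ lift (snd X X) 0 := by
    have hsnd : ∀ g : Z ⟶ X, D.lie (lift (snd X Z ≫ a) 0) (snd X Z ≫ g) = 0 := by
      intro g
      rw [D.lie_comp, (D.isLinear_snd X Z).lie_eq, lift_snd, D.d_arg_zero]
    have hadd : ∀ g g' : X ⊗ Z ⟶ X, D.d (g + g') = D.d g + D.d g' := by
      intro g g'
      have := D.d_csum (fun b : Bool => bif b then g' else g)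
      rwa [csum_bool, csum_bool] at this
    have hfst := (D.isLinear_fst X Z).lie_eq (lift (snd X Z ≫ a) 0)
    have h1 := hsnd x
    have h2 := hsnd a
    rw [Derivative.lie] at h1 h2 hfst ⊢
    rw [D.d_lift, comp_lift, hadd, comp_add, hfst, h1, h2, comp_lift, lift_snd, lift_fst,
      add_zero, comp_zero]
  have hiter : ∀ k : ℕ, (fun g => D.star g a)^[k] (ψ ≫ fst X X ≫ f) =
      ψ ≫ (D.lie (lift (snd X X) 0))^[k] (fst X X ≫ f) := by
    intro k
    induction k with
    | zero => rfl
    | succ k ih =>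
      rw [Function.iterate_succ_apply', Function.iterate_succ_apply', ih,
        ← D.lie_comp_of_related hψ]
      rfl
  have ht := h.taylor (MonoidalClosed.curry (ψ ≫ fst X X ≫ f)) a
  have hev : lift a (MonoidalClosed.curry (ψ ≫ fst X X ≫ f)) ≫ (ihom.ev X).app Y =
      (x + a) ≫ f := by
    rw [← Category.id_comp (MonoidalClosed.curry _), ← lift_whiskerLeft, Category.assoc,
      MonoidalClosed.whiskerLeft_curry_ihom_ev_app]
    simp only [ψ, lift_fst_assoc]
    rw [← Category.assoc, comp_add, lift_fst, lift_snd_assoc, Category.id_comp, add_comm]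
  have hx : lift 0 (𝟙 Z) ≫ ψ = lift x a := by
    simp only [ψ, comp_lift, comp_add, lift_fst, lift_snd_assoc, Category.id_comp, zero_add]
  have hterm : ∀ k : ℕ, lift 0 (𝟙 Z) ≫ (fun g => D.star g a)^[k] (ψ ≫ fst X X ≫ f) =
      tup k (fun i => if i = 0 then x else a) ≫ D.hod f k := by
    intro k
    rw [hiter, ← Category.assoc, hx, iterate_lie_fst, ← Category.assoc, comp_tup]
    congr 2
    funext i
    split_ifs <;> simp
  rw [hev, MonoidalClosed.uncurry_curry] at ht
  simp only [hterm] at ht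
  rw [ht, csum_factorial_smul hR]
  rfl

/-! ### Coherent Taylor expansion -/

theorem isSummability_coherentData : P.coherentData.IsSummability where
  isSum_unique f s t hs ht := hs.symm.trans ht
  isSum_single f := csum_unique f
  exists_zero X Y := ⟨_, rfl⟩
  isSum_partition p f s := by
    constructor
    · rintro rfl
      exact ⟨_, fun j => rfl, (csum_partition p f).symm⟩
    · rintro ⟨g, hg, rfl⟩
      obtain rfl := funext hg
      exact csum_partition p f
  comp_isSum h f s hs := by
    subst hs
    exact (LeftSumCategory.comp_csum h f).symm
  isSum_lift f g s t := by
    change csum _ = _ ↔ csum f = s ∧ csum g = t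
    rw [← D.lift_csum]
    constructor
    · intro h
      have h1 := congrArg (fun q => q ≫ fst _ _) h
      have h2 := congrArg (fun q => q ≫ snd _ _) h
      simp only [lift_fst, lift_snd] at h1 h2
      exact ⟨h1, h2⟩
    · rintro ⟨rfl, rfl⟩
      rfl
  fst_add X Y _ _ _ f s hs := by
    subst hs
    exact ((D.isLinear_fst X Y).csum_comp f).symm
  snd_add X Y _ _ _ f s hs := by
    subst hs
    exact ((D.isLinear_snd X Y).csum_comp f).symm
  proj_add X k _ _ _ f s hs := by
    subst hs
    exact ((P.isLinear_π X k).csum_comp f).symm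
  sum_add X _ _ _ f s hs := by
    subst hs
    exact ((P.isLinear_sum X).csum_comp f).symm
  proj_ext f g h := P.hom_ext h
  isSum_nat f s := by
    constructor
    · rintro rfl
      refine ⟨P.tuple f, P.tuple_π f, ?_⟩
      simp only [comp_sum, tuple_π]
    · rintro ⟨h, hf, rfl⟩
      obtain rfl := funext hf
      exact (P.comp_sum h).symm
  summable_obj h := ⟨fun _ => ⟨_, rfl⟩, fun _ => ⟨_, rfl⟩⟩

theorem isZero_coherentData {z : X ⟶ Y} : P.coherentData.IsZero z ↔ z = 0 :=
  ⟨fun h => h.symm.trans (csum_empty _), fun h => (csum_empty _).trans h.symm⟩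

theorem isCoordinatewise_coherentData (hR : HasIntegerInverses R) {f : X ⟶ Y}
    (hf : D.IsLinear f) : P.coherentData.IsCoordinatewise f := fun k =>
  (congrArg (fun g => g ≫ P.π Y k) (P.T_eq_map hR hf)).trans (P.map_π f k)

theorem isAnalyticTaylorExpansion_coherentData (hR : HasIntegerInverses R)
    (hT : P.IsAnalytic P.T) : P.coherentData.IsAnalyticTaylorExpansion where
  toIsSummability := P.isSummability_coherentData
  map_id := P.T_id hR
  map_comp := P.T_comp hR
  map_fst X Y := P.isCoordinatewise_coherentData hR (D.isLinear_fst X Y)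
  map_snd X Y := P.isCoordinatewise_coherentData hR (D.isLinear_snd X Y)
  map_proj X k := P.isCoordinatewise_coherentData hR (P.isLinear_π X k)
  map_sum X := P.isCoordinatewise_coherentData hR (P.isLinear_sum X)
  map_zero z hz := by
    rw [isZero_coherentData] at hz
    subst hz
    exact P.isCoordinatewise_coherentData hR (D.isLinear_zero _ _)
  proj_natural := P.T_π_zero
  inj_natural := by
    refine ⟨P.inj, fun X => ⟨P.inj_π_zero X, fun k hk => ?_⟩, P.inj_natural hR⟩
    rw [isZero_coherentData]
    obtain ⟨k, rfl⟩ := Nat.exists_eq_succ_of_ne_zero hk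
    exact P.inj_π_succ X k
  mult_natural := by
    refine ⟨P.mult, fun X k => ?_, P.mult_natural hR⟩
    let e : {p : ℕ × ℕ // p ∈ Finset.HasAntidiagonal.antidiagonal k} ≃
        {p : ℕ × ℕ // p.1 + p.2 = k} := Equiv.subtypeEquivRight (by simp)
    rw [mult_π, ← csum_finset]
    exact (csum_equiv e _).symm
  swap_natural := by
    refine ⟨P.swap, fun X i j => ?_, P.swap_natural hR⟩
    rw [← Category.assoc, swap_π, map_π]
  diag_natural := by
    refine ⟨P.diag, fun X i => ?_, fun X i j hij => ?_, P.diag_natural hR⟩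
    · rw [diag_π_π, if_pos rfl]
    · rw [isZero_coherentData, diag_π_π, if_neg hij]
  sum_natural := hT.sum_natural

end OmegaPowers

end TaylorCat

end

theorem mainTheorem8
    {R : Type w} [CommSemiring R] [TaylorCat.CountableSums R] [TaylorCat.CompleteSemiring R]
    (hR : TaylorCat.HasIntegerInverses R)
    {C : Type u} [Category.{v} C] [CartesianMonoidalCategory C]
    [TaylorCat.LeftSumCategory C] [TaylorCat.LeftAdditiveCategory R C]
    [TaylorCat.CartesianLeftAdditive R C]
    (D : TaylorCat.Derivative R C) (P : TaylorCat.OmegaPowers D) :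
    P.IsTaylorExpansion P.T ∧
    (D.IsTaylor ↔ P.IsAnalytic P.T) ∧
    (∀ [MonoidalClosed C], D.ModelsTaylorExpansion →
      P.coherentData.IsAnalyticTaylorExpansion) := by
  refine ⟨P.isTaylorExpansion_T hR, P.isTaylor_iff_isAnalytic hR, fun h => ?_⟩
  have hT := TaylorCat.OmegaPowers.isTaylor_of_modelsTaylorExpansion hR h
  exact P.isAnalyticTaylorExpansion_coherentData hR ((P.isTaylor_iff_isAnalytic hR).mp hT)
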